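/- Notation. $\log$ is the base-2 logarithm. For permutations $\pi,\pi'$ of $[n]$, $\mathrm{Swap}(\pi,\pi')$ is the minimum number of coordinate swaps (changes of a permutation at exactly two elements of $[n]$) that turn $\pi$ into $\pi'$. A random permutation $\mathcal S$ of $[n]$ is a $\gamma$-imperfect shuffler if $\Pr[\mathcal S=\pi]\le e^{\gamma\,\mathrm{Swap}(\pi,\pi')}\Pr[\mathcal S=\pi']$ for all permutations $\pi,\pi'$ of $[n]$. An $n$-party protocol with $m$ messages per party in the $\gamma$-I-shuffle model consists of a local randomizer, which each party applies independently to its input to produce $m$ messages from a finite message space, and an analyzer. For each round $j\in[m]$, the $j$-th messages of the $n$ parties are permuted by a random permutation drawn, independently for each round and of the messages, from a $\gamma$-imperfect shuffler $\mathcal S^{(j)}$. The analyzer sees only the $m$ shuffled lists of $n$ messages (the view) and computes the output from them. The protocol is chosen without knowledge of the shufflers. It is $(\varepsilon,\delta)$-DP if, for every choice of $\gamma$-imperfect shufflers $\mathcal S^{(1)},\dots,\mathcal S^{(m)}$, all input datasets $x,x'$ that differ in the input of one party, and every set $T$ of views, $\Pr[\mathrm{view}(x)\in T]\le e^{\varepsilon}\Pr[\mathrm{view}(x')\in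 T]+\delta$. Theorem (private vector summation). For every $\varepsilon_0>0$ there is a constant $C>0$, depending only on $\varepsilon_0$, such that the following holds. Let $n\ge 19$, $d\ge 1$, $0<\varepsilon\le\varepsilon_0$, $0<\delta<1$ and $0\le\gamma\le\frac{\log\log n}{80}$. Then there is an $(\varepsilon,\delta)$-DP protocol in the $\gamma$-I-shuffle model for $n$ parties holding vectors $\vec x_1,\dots,\vec x_n\in[0,1]^d$, in which each party sends \[m\le C\,d\left(e^{4\gamma}+\frac{e^{4\gamma}\left(\log\frac d\delta+\log n\right)}{\log n}\right)\] messages, each of at most $C\log q$ bits with $q=\lceil 2n^{3/2}\rceil$, and whose output estimates $\sum_{i=1}^n\vec x_i$ with expected absolute error at most $C\,\frac d\varepsilon$ in each coordinate, for all inputs and all $\gamma$-imperfect shufflers $\mathcal S^{(1)},\dots,\mathcal S^{(m)}$. -/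

import Mathlib

/-- The law of a finite family of independent random variables with finite value spaces. -/
noncomputable def indepPMF {ι : Type} [Fintype ι] [DecidableEq ι] {α : Type} [Fintype α]
    (p : ι → PMF α) : PMF (ι → α) :=
  PMF.ofFintype (fun f => ∏ i, p i (f i)) (by
    have h : ∀ i, ∑ a, p i a = 1 := fun i => by
      rw [← tsum_fintype (L := SummationFilter.unconditional α)]; exact (p i).tsum_coe
    rw [← Fintype.prod_sum]
    simp [h])

/-- The graph on the permutations of `[n]` in which two permutations are adjacent when they
result from each other by one coordinate swap, i.e. agree on all except two elements of `[n]`. -/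
def swapGraph (n : ℕ) : SimpleGraph (Equiv.Perm (Fin n)) where
  Adj π π' := (Finset.univ.filter fun i => π i ≠ π' i).card = 2
  symm := ⟨fun π π' h => by simpa only [ne_comm] using h⟩
  loopless := ⟨fun π h => by simp at h⟩

/-- The minimum number of coordinate swaps that turn `π` into `π'`.  (Any two permutations are
connected by coordinate swaps, so the graph distance never takes its junk value.) -/
noncomputable def swapDist {n : ℕ} (π π' : Equiv.Perm (Fin n)) : ℕ :=
  (swapGraph n).dist π π'

/-- A shuffler (a random permutation of `[n]`) is `γ`-imperfect if
`Pr[S = π] ≤ e^(γ * Swap(π, π')) * Pr[S = π']` for all permutations `π`, `π'`. -/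
def IsImperfectShuffler {n : ℕ} (γ : ℝ) (S : PMF (Equiv.Perm (Fin n))) : Prop :=
  ∀ π π' : Equiv.Perm (Fin n),
    S π ≤ ENNReal.ofReal (Real.exp (γ * (swapDist π π' : ℝ))) * S π'

/-- `(ε, δ)`-differential privacy of a randomized algorithm on datasets of `n` entries; datasets
are neighbours when they differ in the entry of at most one party. -/
def IsDP {n : ℕ} {X Ω : Type} (ε δ : ℝ) (A : (Fin n → X) → PMF Ω) : Prop :=
  ∀ x x' : Fin n → X, (∃ i, ∀ j, j ≠ i → x j = x' j) → ∀ T : Set Ω,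
    (A x).toOuterMeasure T ≤
      ENNReal.ofReal (Real.exp ε) * (A x').toOuterMeasure T + ENNReal.ofReal δ

/-- An `n`-party shuffle-model protocol with inputs in `X` in which each party sends `m` messages
from the message space `M`: every party applies the local randomizer to its input, and the
analyzer computes the output from the shuffled messages (`v j k` is the message that arrives at
position `k` in round `j`). -/
structure ShuffleProtocol (X M Y : Type) (n m : ℕ) where
  randomizer : X → PMF (Fin m → M)
  analyzer : (Fin m → Fin n → M) → Y

/-- The curator's view of the protocol on the inputs `x`: the parties draw their messages
independently, and for each round `j` the `j`-th messages of the `n` parties are permuted by an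
independent permutation drawn from `S j`, where the message of party `i` goes to position
`π j i`. -/
noncomputable def ShuffleProtocol.view {X M Y : Type} [Fintype M] {n m : ℕ}
    (P : ShuffleProtocol X M Y n m) (S : Fin m → PMF (Equiv.Perm (Fin n))) (x : Fin n → X) :
    PMF (Fin m → Fin n → M) :=
  (indepPMF fun i => P.randomizer (x i)).bind fun msg =>
    (indepPMF S).map fun π j k => msg ((π j).symm k) j

/-- The expected absolute error of coordinate `k` of the output, as an estimate of the
`k`-th coordinate of the sum of the input vectors. -/
noncomputable def ShuffleProtocol.expectedAbsError {M : Type} [Fintype M] {n m d : ℕ}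
    (P : ShuffleProtocol (Fin d → Set.Icc (0 : ℝ) 1) M (Fin d → ℝ) n m)
    (S : Fin m → PMF (Equiv.Perm (Fin n))) (x : Fin n → Fin d → Set.Icc (0 : ℝ) 1)
    (k : Fin d) : ℝ :=
  ∑ v, (P.view S x v).toReal * |P.analyzer v k - ∑ i, (x i k : ℝ)|

set_option linter.unusedSectionVars false

section Rearrangements

open Finset

variable {ι V : Type} [Fintype ι] [DecidableEq ι] [Fintype V] [DecidableEq V]

/-- The number of positions in `A` at which `f` takes the value `v`. -/
def countOn (A : Finset ι) (f : ι → V) (v : V) : ℕ := (A.filter fun i => f i = v).card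

/-- The rearrangements of `f` that agree with `f` off `A`. -/
def rearr (A : Finset ι) (f : ι → V) : Finset (ι → V) :=
  univ.filter fun h => (∀ i ∉ A, h i = f i) ∧ ∀ v, countOn A h v = countOn A f v

lemma mem_rearr {A : Finset ι} {f h : ι → V} :
    h ∈ rearr A f ↔ (∀ i ∉ A, h i = f i) ∧ ∀ v, countOn A h v = countOn A f v := by
  simp [rearr]

/-- The multinomial coefficient of the value counts of `f` on `A`. -/
noncomputable def multinom (A : Finset ι) (f : ι → V) : ℝ :=
  (A.card.factorial : ℝ) / ∏ v, ((countOn A f v).factorial : ℝ)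

lemma multinom_pos (A : Finset ι) (f : ι → V) : 0 < multinom A f := by
  unfold multinom
  have : ∀ k : ℕ, (0 : ℝ) < (k.factorial : ℝ) := fun k => by exact_mod_cast k.factorial_pos
  exact div_pos (this _) (Finset.prod_pos fun v _ => this _)

lemma multinom_empty (f : ι → V) : multinom ∅ f = 1 := by
  simp [multinom, countOn]

lemma sum_countOn (A : Finset ι) (f : ι → V) : ∑ v, countOn A f v = A.card := by
  unfold countOn
  exact (Finset.card_eq_sum_card_fiberwise (fun _ _ => mem_coe.2 (mem_univ _))).symm

lemma countOn_erase {A : Finset ι} {k : ι} (hk : k ∈ A) (f : ι → V) (v : V) :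
    countOn A f v = countOn (A.erase k) f v + if f k = v then 1 else 0 := by
  unfold countOn
  nth_rewrite 1 [← Finset.insert_erase hk]
  rw [Finset.filter_insert]
  split_ifs with h
  · rw [Finset.card_insert_of_notMem (by simp)]
  · simp

lemma countOn_swap {A : Finset ι} {k j : ι} (hk : k ∈ A) (hj : j ∈ A) (f : ι → V) (v : V) :
    countOn A (f ∘ Equiv.swap k j) v = countOn A f v := by
  have hA : ∀ i, Equiv.swap k j i ∈ A ↔ i ∈ A := by
    intro i
    rcases eq_or_ne i k with rfl | h1
    · simp [hk, hj]
    rcases eq_or_ne i j with rfl | h2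
    · simp [hk, hj]
    · rw [Equiv.swap_apply_of_ne_of_ne h1 h2]
  unfold countOn
  refine Finset.card_bij' (fun i _ => Equiv.swap k j i) (fun i _ => Equiv.swap k j i) ?_ ?_ ?_ ?_
  · intro i hi; simp only [mem_filter, Function.comp_apply] at hi ⊢; exact ⟨(hA i).2 hi.1, hi.2⟩
  · intro i hi; simp only [mem_filter, Function.comp_apply] at hi ⊢
    exact ⟨(hA i).2 hi.1, by simpa using hi.2⟩
  · simp
  · simp

lemma multinom_erase_swap {A : Finset ι} {k j : ι} (hk : k ∈ A) (hj : j ∈ A) (f : ι → V) :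
    multinom (A.erase k) (f ∘ Equiv.swap k j) =
      multinom A f * (countOn A f (f j) / A.card) := by
  set g := f ∘ Equiv.swap k j with hg
  have hgk : g k = f j := by simp [hg]
  have hM : multinom A f = multinom A g := by
    unfold multinom; simp [hg, countOn_swap hk hj]
  have hc : countOn A f (f j) = countOn A g (f j) := by simp [hg, countOn_swap hk hj]
  rw [hM, hc]
  have hcard : A.card = (A.erase k).card + 1 := by rw [Finset.card_erase_add_one hk]
  have h1 : countOn A g (f j) = countOn (A.erase k) g (f j) + 1 := by
    rw [countOn_erase hk g (f j), if_pos hgk]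
  have hprod : ∏ v, ((countOn A g v).factorial : ℝ) =
      (countOn (A.erase k) g (f j) + 1 : ℕ) * ∏ v, ((countOn (A.erase k) g v).factorial : ℝ) := by
    rw [← Finset.mul_prod_erase univ _ (mem_univ (f j)),
      ← Finset.mul_prod_erase univ (fun v => ((countOn (A.erase k) g v).factorial : ℝ))
        (mem_univ (f j)), h1, Nat.factorial_succ]
    push_cast
    rw [mul_assoc]
    congr 2
    refine Finset.prod_congr rfl fun v hv => ?_
    rw [countOn_erase hk g v, if_neg (by rw [hgk]; exact (ne_of_mem_erase hv).symm), add_zero]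
  unfold multinom
  rw [hprod, hcard, Nat.factorial_succ, h1]
  have : ∏ v, ((countOn (A.erase k) g v).factorial : ℝ) ≠ 0 :=
    Finset.prod_ne_zero_iff.2 fun v _ => by exact_mod_cast Nat.factorial_ne_zero _
  push_cast
  field_simp

lemma rearr_filter {A : Finset ι} {k j : ι} (hk : k ∈ A) (hj : j ∈ A) (f : ι → V) :
    (rearr A f).filter (fun h => h k = f j) = rearr (A.erase k) (f ∘ Equiv.swap k j) := by
  ext h
  simp only [rearr, mem_filter, mem_univ, true_and]
  set g := f ∘ Equiv.swap k j with hg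
  have hgk : g k = f j := by simp [hg]
  have hgo : ∀ i ∉ A, g i = f i := by
    intro i hi
    simp only [hg, Function.comp_apply]
    rw [Equiv.swap_apply_of_ne_of_ne]
    · rintro rfl; exact hi hk
    · rintro rfl; exact hi hj
  have hc : ∀ v, countOn A f v = countOn A g v := fun v => by simp [hg, countOn_swap hk hj]
  constructor
  · rintro ⟨⟨h1, h2⟩, h3⟩
    refine ⟨fun i hi => ?_, fun v => ?_⟩
    · rcases eq_or_ne i k with rfl | hik
      · rw [h3, hgk]
      · have : i ∉ A := fun hA => hi (mem_erase.2 ⟨hik, hA⟩)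
        rw [h1 i this, hgo i this]
    · have := h2 v
      rw [hc, countOn_erase hk h, countOn_erase hk g, h3, hgk] at this
      omega
  · rintro ⟨h1, h2⟩
    have h3 : h k = f j := by rw [h1 k (by simp), hgk]
    refine ⟨⟨fun i hi => ?_, fun v => ?_⟩, h3⟩
    · rw [h1 i (fun hA => hi (mem_erase.1 hA).2), hgo i hi]
    · rw [hc, countOn_erase hk h, countOn_erase hk g, h3, hgk, h2 v]

lemma countOn_pos_iff {A : Finset ι} {f : ι → V} {v : V} :
    0 < countOn A f v ↔ v ∈ A.image f := by
  simp [countOn, Finset.card_pos, Finset.Nonempty]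

/-- Rearrangements, sorted by their value at a fixed position `k`. -/
lemma sum_rearr {A : Finset ι} {k : ι} (hk : k ∈ A) (f : ι → V) (j : V → ι)
    (hj : ∀ v ∈ A.image f, j v ∈ A ∧ f (j v) = v) (F : (ι → V) → ℝ) :
    ∑ h ∈ rearr A f, F h =
      ∑ v ∈ A.image f, ∑ h ∈ rearr (A.erase k) (f ∘ Equiv.swap k (j v)), F h := by
  rw [← Finset.sum_fiberwise_of_maps_to (s := rearr A f) (t := A.image f) (g := fun h => h k)]
  · refine Finset.sum_congr rfl fun v hv => ?_
    rw [← rearr_filter hk (hj v hv).1, (hj v hv).2]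
  · intro h hh
    simp only [rearr, mem_filter] at hh
    rw [← countOn_pos_iff, ← hh.2.2 (h k), countOn_pos_iff]
    exact mem_image_of_mem _ hk

lemma exists_position (A : Finset ι) (f : ι → V) (k : ι) (hk : k ∈ A) :
    ∃ j : V → ι, (∀ v ∈ A.image f, j v ∈ A ∧ f (j v) = v) ∧ j (f k) = k := by
  classical
  have h : ∀ v, ∃ i, (v ∈ A.image f → i ∈ A ∧ f i = v) ∧ (v = f k → i = k) := by
    intro v
    by_cases hv : v = f k
    · exact ⟨k, fun _ => ⟨hk, hv.symm⟩, fun _ => rfl⟩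
    · by_cases hv' : v ∈ A.image f
      · obtain ⟨i, hi, hiv⟩ := mem_image.1 hv'
        exact ⟨i, fun _ => ⟨hi, hiv⟩, fun h => absurd h hv⟩
      · exact ⟨k, fun h => absurd h hv', fun h => absurd h hv⟩
  choose j hj using h
  exact ⟨j, fun v hv => (hj v).1 hv, (hj _).2 rfl⟩

lemma sum_freq (A : Finset ι) (hA : A.Nonempty) (f : ι → V) :
    ∑ v ∈ A.image f, ((countOn A f v : ℝ) / A.card) = 1 := by
  have h1 : ∑ v ∈ A.image f, (countOn A f v : ℝ) = A.card := by
    rw [← sum_countOn A f]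
    push_cast
    refine Finset.sum_subset (subset_univ _) fun v _ hv => ?_
    have : ¬ 0 < countOn A f v := fun h => hv (countOn_pos_iff.1 h)
    exact_mod_cast Nat.eq_zero_of_not_pos this
  rw [← Finset.sum_div, h1, div_self]
  exact_mod_cast hA.card_pos.ne'

lemma card_rearr (A : Finset ι) : ∀ f : ι → V, ((rearr A f).card : ℝ) = multinom A f := by
  induction A using Finset.strongInduction with
  | H A ih =>
    intro f
    rcases A.eq_empty_or_nonempty with rfl | ⟨k, hk⟩
    · rw [multinom_empty]
      have : rearr ∅ f = {f} := by
        ext h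
        simp [rearr, countOn, funext_iff]
      simp [this]
    · obtain ⟨j, hj, -⟩ := exists_position A f k hk
      have := sum_rearr hk f j hj (fun _ => 1)
      simp only [sum_const, nsmul_eq_mul, mul_one] at this
      rw [this]
      calc _ = ∑ v ∈ A.image f, multinom A f * (countOn A f v / A.card) :=
            Finset.sum_congr rfl fun v hv => by
              rw [ih _ (Finset.erase_ssubset hk), multinom_erase_swap hk (hj v hv).1, (hj v hv).2]
        _ = _ := by rw [← Finset.mul_sum, sum_freq A ⟨k, hk⟩, mul_one]

lemma one_le_weighted_rpow_sum {W : Type} [DecidableEq W] (s : Finset W) (p : W → ℝ) (u : W)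
    (hu : u ∈ s) (hp : ∀ v ∈ s, 0 < p v) (hmax : ∀ v ∈ s, p v ≤ p u) (hsum : ∑ v ∈ s, p v = 1)
    {y : ℝ} (hy : 0 ≤ y) (hy1 : y ≤ 1) :
    1 ≤ ∑ v ∈ s, (if v = u then 1 else y) * p v ^ y := by
  have hpu := hp u hu
  have hterm : ∀ v ∈ s, p v * p u ^ (y - 1) ≤ p v ^ y := by
    intro v hv
    have hpv := hp v hv
    calc p v * p u ^ (y - 1) ≤ p v * p v ^ (y - 1) := by
          refine mul_le_mul_of_nonneg_left ?_ hpv.le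
          exact Real.rpow_le_rpow_of_nonpos hpv (hmax v hv) (by linarith)
      _ = p v ^ y := by
          rw [Real.rpow_sub_one hpv.ne']; field_simp
  have hsum' : ∑ v ∈ s, (if v = u then 1 else y) * p v = (1 - y) * p u + y := by
    have : ∀ v ∈ s, (if v = u then 1 else y) * p v = (if v = u then (1 - y) * p v else 0) + y * p v := by
      intro v _; split_ifs <;> ring
    rw [Finset.sum_congr rfl this, Finset.sum_add_distrib, ← Finset.mul_sum, hsum,
      Finset.sum_ite_eq' s u]
    simp [hu]
  have hamgm : p u ^ (1 - y) ≤ (1 - y) * p u + y := by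
    have := Real.geom_mean_le_arith_mean2_weighted (by linarith : 0 ≤ 1 - y) hy hpu.le
      (zero_le_one) (by ring)
    simpa using this
  calc (1 : ℝ) = p u ^ (1 - y) * p u ^ (y - 1) := by
        rw [← Real.rpow_add hpu]; simp
    _ ≤ ((1 - y) * p u + y) * p u ^ (y - 1) := by gcongr
    _ = ∑ v ∈ s, (if v = u then 1 else y) * (p v * p u ^ (y - 1)) := by
        rw [← hsum', Finset.sum_mul]
        exact Finset.sum_congr rfl fun v _ => by ring
    _ ≤ _ := by
        refine Finset.sum_le_sum fun v hv => mul_le_mul_of_nonneg_left (hterm v hv) ?_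
        split_ifs <;> linarith

/-- If every transposition changes the weight by a factor of at least `y`, then the total weight
of the rearrangements of `f` is at least `multinom A f ^ y` times the weight of `f`. -/
lemma weight_mul_multinom_rpow_le {μ : (ι → V) → ℝ} {y : ℝ} (hy : 0 ≤ y) (hy1 : y ≤ 1)
    (hμ0 : ∀ h, 0 ≤ μ h) (hμ : ∀ h i j, y * μ h ≤ μ (h ∘ Equiv.swap i j)) (A : Finset ι) :
    ∀ f : ι → V, μ f * multinom A f ^ y ≤ ∑ h ∈ rearr A f, μ h := by
  induction A using Finset.strongInduction with
  | H A ih =>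
    intro f
    rcases A.eq_empty_or_nonempty with rfl | hA
    · rw [multinom_empty]
      have : rearr ∅ f = {f} := by
        ext h
        simp [rearr, countOn, funext_iff]
      simp [this]
    · obtain ⟨k, hk, hmax⟩ := Finset.exists_max_image A (fun i => countOn A f (f i)) hA
      obtain ⟨j, hj, hjk⟩ := exists_position A f k hk
      rw [sum_rearr hk f j hj]
      have hM := multinom_pos A f
      have hmain := one_le_weighted_rpow_sum (A.image f) (fun v => (countOn A f v : ℝ) / A.card)
        (f k) (mem_image_of_mem _ hk)
        (fun v hv => div_pos (by exact_mod_cast countOn_pos_iff.2 hv)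
          (by exact_mod_cast hA.card_pos))
        (fun v hv => by
          obtain ⟨i, hi, rfl⟩ := mem_image.1 hv
          have := hmax i hi
          gcongr)
        (sum_freq A hA f) hy hy1
      calc μ f * multinom A f ^ y ≤ μ f * multinom A f ^ y * ∑ v ∈ A.image f,
            (if v = f k then 1 else y) * ((countOn A f v : ℝ) / A.card) ^ y :=
            le_mul_of_one_le_right (mul_nonneg (hμ0 f) (Real.rpow_nonneg hM.le _)) hmain
        _ = ∑ v ∈ A.image f, ((if v = f k then 1 else y) * μ f) *
              (multinom A f * ((countOn A f v : ℝ) / A.card)) ^ y := by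
            rw [Finset.mul_sum]
            refine Finset.sum_congr rfl fun v _ => ?_
            rw [Real.mul_rpow hM.le (by positivity)]
            ring
        _ ≤ _ := by
            refine Finset.sum_le_sum fun v hv => ?_
            have h1 := ih _ (Finset.erase_ssubset hk) (f ∘ Equiv.swap k (j v))
            rw [multinom_erase_swap hk (hj v hv).1, (hj v hv).2] at h1
            refine le_trans (mul_le_mul_of_nonneg_right ?_ (by positivity)) h1
            split_ifs with hv'
            · subst hv'; simp [hjk]
            · exact hμ _ _ _

end Rearrangements

section Matching

open Finset

variable {V : Type} [Fintype V] [DecidableEq V] {n : ℕ}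

lemma PMF.sum_toReal {α : Type} [Fintype α] (p : PMF α) : ∑ a, (p a).toReal = 1 := by
  rw [← ENNReal.toReal_sum fun a _ => p.apply_ne_top a,
    ← tsum_fintype (L := SummationFilter.unconditional α), p.tsum_coe, ENNReal.toReal_one]

/-- The probability that the random permutation rearranges `f` into `ψ`. -/
noncomputable def matchProb (p : PMF (Equiv.Perm (Fin n))) (f ψ : Fin n → V) : ℝ :=
  ∑ π, (p π).toReal * if f ∘ π = ψ then 1 else 0

lemma matchProb_nonneg (p : PMF (Equiv.Perm (Fin n))) (f ψ : Fin n → V) :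
    0 ≤ matchProb p f ψ :=
  Finset.sum_nonneg fun π _ => mul_nonneg ENNReal.toReal_nonneg (by split_ifs <;> norm_num)

lemma sum_matchProb_right (p : PMF (Equiv.Perm (Fin n))) (f : Fin n → V) :
    ∑ ψ, matchProb p f ψ = 1 := by
  unfold matchProb
  rw [Finset.sum_comm]
  refine Eq.trans ?_ p.sum_toReal
  exact Finset.sum_congr rfl fun π _ => by rw [← Finset.mul_sum]; simp

lemma sum_matchProb_left (p : PMF (Equiv.Perm (Fin n))) (ψ : Fin n → V) :
    ∑ f, matchProb p f ψ = 1 := by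
  unfold matchProb
  rw [Finset.sum_comm]
  refine Eq.trans (Finset.sum_congr rfl fun π _ => ?_) p.sum_toReal
  have : ∀ f : Fin n → V, f ∘ π = ψ ↔ f = ψ ∘ π.symm := fun f => by
    rw [Equiv.eq_comp_symm]
  rw [← Finset.mul_sum]
  simp [this]

lemma countOn_univ_comp (f : Fin n → V) (π : Equiv.Perm (Fin n)) (v : V) :
    countOn univ (f ∘ π) v = countOn univ f v := by
  unfold countOn
  refine Finset.card_bij' (fun i _ => π i) (fun i _ => π.symm i) ?_ ?_ ?_ ?_ <;> simp

lemma countOn_eq_of_matchProb_ne_zero {p : PMF (Equiv.Perm (Fin n))} {f ψ : Fin n → V}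
    (h : matchProb p f ψ ≠ 0) (v : V) : countOn univ f v = countOn univ ψ v := by
  obtain ⟨π, -, hπ⟩ := Finset.exists_ne_zero_of_sum_ne_zero h
  have : f ∘ π = ψ := by by_contra h'; simp [h'] at hπ
  rw [← this, countOn_univ_comp]

lemma multinom_congr {f ψ : Fin n → V} (h : ∀ v, countOn univ f v = countOn univ ψ v) :
    multinom univ f = multinom univ ψ := by
  simp only [multinom, h]

lemma swapDist_swap_mul_le (i j : Fin n) (π : Equiv.Perm (Fin n)) :
    swapDist π (Equiv.swap i j * π) ≤ 1 := by
  unfold swapDist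
  rcases eq_or_ne i j with rfl | hij
  · rw [Equiv.swap_self, ← Equiv.Perm.one_def, one_mul, SimpleGraph.dist_self]
    exact zero_le_one
  · refine (SimpleGraph.dist_eq_one_iff_adj.2 ?_).le
    change (Finset.univ.filter fun k => π k ≠ (Equiv.swap i j * π) k).card = 2
    rw [← Equiv.Perm.card_support_swap hij]
    refine Finset.card_bij' (fun k _ => π k) (fun k _ => π.symm k) ?_ ?_ ?_ ?_
    · intro k hk
      exact Equiv.Perm.mem_support.2 (Finset.mem_filter.1 hk).2.symm
    · intro k hk
      have := Equiv.Perm.mem_support.1 hk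
      refine Finset.mem_filter.2 ⟨mem_univ _, ?_⟩
      simpa [Equiv.Perm.mul_apply] using this.symm
    · simp
    · simp

lemma matchProb_swap {γ : ℝ} (hγ : 0 ≤ γ) {p : PMF (Equiv.Perm (Fin n))}
    (hp : IsImperfectShuffler γ p) (ψ h : Fin n → V) (i j : Fin n) :
    Real.exp (-γ) * matchProb p h ψ ≤ matchProb p (h ∘ Equiv.swap i j) ψ := by
  unfold matchProb
  rw [← Equiv.sum_comp (Equiv.mulLeft (Equiv.swap i j))
    (fun π : Equiv.Perm (Fin n) => (p π).toReal * if (h ∘ Equiv.swap i j) ∘ π = ψ then (1 : ℝ) else 0),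
    Finset.mul_sum]
  refine Finset.sum_le_sum fun π _ => ?_
  have h1 : (h ∘ Equiv.swap i j) ∘ (Equiv.mulLeft (Equiv.swap i j) π) = h ∘ π := by
    ext k; simp
  rw [h1, ← mul_assoc]
  refine mul_le_mul_of_nonneg_right ?_ (by split_ifs <;> norm_num)
  simp only [Equiv.coe_mulLeft]
  have h2 := ENNReal.toReal_mono (ENNReal.mul_ne_top ENNReal.ofReal_ne_top (p.apply_ne_top _))
    (hp π (Equiv.swap i j * π))
  rw [ENNReal.toReal_mul, ENNReal.toReal_ofReal (Real.exp_pos _).le] at h2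
  have h3 : Real.exp (γ * (swapDist π (Equiv.swap i j * π) : ℝ)) ≤ Real.exp γ := by
    refine Real.exp_le_exp.2 (mul_le_of_le_one_right hγ ?_)
    exact_mod_cast swapDist_swap_mul_le i j π
  calc Real.exp (-γ) * (p π).toReal
      ≤ Real.exp (-γ) * (Real.exp γ * (p (Equiv.swap i j * π)).toReal) := by
        refine mul_le_mul_of_nonneg_left (h2.trans ?_) (Real.exp_pos _).le
        exact mul_le_mul_of_nonneg_right h3 ENNReal.toReal_nonneg
    _ = _ := by rw [← mul_assoc, ← Real.exp_add]; simp

lemma matchProb_le {γ : ℝ} (hγ : 0 ≤ γ) {p : PMF (Equiv.Perm (Fin n))}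
    (hp : IsImperfectShuffler γ p) (f ψ : Fin n → V) :
    matchProb p f ψ ≤ multinom univ f ^ (-Real.exp (-γ)) := by
  have h := weight_mul_multinom_rpow_le (μ := fun h => matchProb p h ψ) (Real.exp_pos (-γ)).le
    (Real.exp_le_one_iff.2 (by linarith)) (fun h => matchProb_nonneg p h ψ)
    (fun h i j => matchProb_swap hγ hp ψ h i j) univ f
  have h1 : ∑ h ∈ rearr univ f, matchProb p h ψ ≤ 1 := by
    rw [← sum_matchProb_left p ψ]
    exact Finset.sum_le_sum_of_subset_of_nonneg (subset_univ _)
      fun h _ _ => matchProb_nonneg p h ψ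
  have hM := multinom_pos (univ : Finset (Fin n)) f
  rw [Real.rpow_neg hM.le, ← one_div, le_div_iff₀ (Real.rpow_pos_of_pos hM _)]
  exact h.trans h1

end Matching

section Types

open Finset

lemma factorial_succ_mul_le (a b : ℕ) :
    (a + 1).factorial * (b + 1).factorial ≤ (a + b + 1).factorial := by
  induction b with
  | zero => simp
  | succ b ih =>
    rw [Nat.factorial_succ (b + 1), show a + (b + 1) + 1 = (a + b + 1) + 1 by ring,
      Nat.factorial_succ (a + b + 1)]
    calc _ = (b + 1 + 1) * ((a + 1).factorial * (b + 1).factorial) := by ring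
      _ ≤ _ := Nat.mul_le_mul (by omega) ih

lemma prod_factorial_succ_le {W : Type} [DecidableEq W] (T : Finset W) (s : W → ℕ) :
    ∏ v ∈ T, (s v + 1).factorial ≤ (∑ v ∈ T, s v + 1).factorial := by
  induction T using Finset.induction_on with
  | empty => simp
  | insert a T ha ih =>
    rw [Finset.prod_insert ha, Finset.sum_insert ha]
    exact (Nat.mul_le_mul_left _ ih).trans (factorial_succ_mul_le _ _)

lemma pow_le_descFactorial_sq {n k : ℕ} (hk : k ≤ n) : n ^ k ≤ n.descFactorial k ^ 2 := by
  rw [Nat.descFactorial_eq_prod_range, sq]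
  nth_rewrite 2 [← Finset.prod_range_reflect]
  rw [← Finset.prod_mul_distrib]
  calc n ^ k = ∏ _i ∈ range k, n := by simp
    _ ≤ _ := by
      refine Finset.prod_le_prod' fun i hi => ?_
      have hi := mem_range.1 hi
      obtain ⟨a, ha⟩ : ∃ a, n - i = a + 1 := ⟨n - i - 1, by omega⟩
      obtain ⟨b, hb⟩ : ∃ b, n - (k - 1 - i) = b + 1 := ⟨n - (k - 1 - i) - 1, by omega⟩
      rw [ha, hb]
      have : n ≤ a + b + 1 := by omega
      nlinarith [Nat.zero_le (a * b)]

variable {V : Type} [Fintype V] [DecidableEq V] {n : ℕ}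

lemma descFactorial_le_multinom (ψ : Fin n → V) (hn : 0 < n) :
    ((n.descFactorial ((univ.image ψ).card - 1) : ℕ) : ℝ) ≤ multinom univ ψ := by
  set T := univ.image ψ with hT
  have hne : T.Nonempty := ⟨ψ ⟨0, hn⟩, mem_image_of_mem _ (mem_univ _)⟩
  have hcard : T.card ≤ n := by simpa using Finset.card_image_le (s := univ) (f := ψ)
  have hpos : ∀ v ∈ T, 0 < countOn univ ψ v := fun v hv => countOn_pos_iff.2 hv
  have hprod : ∏ v, (countOn univ ψ v).factorial = ∏ v ∈ T, (countOn univ ψ v - 1 + 1).factorial := by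
    rw [← Finset.prod_subset (subset_univ T)]
    · exact Finset.prod_congr rfl fun v hv => by rw [Nat.sub_add_cancel (hpos v hv)]
    · intro v _ hv
      have : ¬ 0 < countOn univ ψ v := fun h => hv (countOn_pos_iff.1 h)
      rw [Nat.eq_zero_of_not_pos this, Nat.factorial_zero]
  have hsum : ∑ v ∈ T, (countOn univ ψ v - 1) + T.card = n := by
    rw [Finset.card_eq_sum_ones, ← Finset.sum_add_distrib]
    have h2 := sum_countOn (univ : Finset (Fin n)) ψ
    rw [card_univ, Fintype.card_fin] at h2
    refine Eq.trans ?_ h2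
    rw [← Finset.sum_subset (subset_univ T)]
    · exact Finset.sum_congr rfl fun v hv => Nat.sub_add_cancel (hpos v hv)
    · intro v _ hv
      have : ¬ 0 < countOn univ ψ v := fun h => hv (countOn_pos_iff.1 h)
      exact Nat.eq_zero_of_not_pos this
  have hle := prod_factorial_succ_le T (fun v => countOn univ ψ v - 1)
  rw [← hprod] at hle
  have hc := hne.card_pos
  have h3 : ∑ v ∈ T, (countOn univ ψ v - 1) + 1 = n - (T.card - 1) := by omega
  rw [h3] at hle
  have h4 := Nat.factorial_mul_descFactorial (show T.card - 1 ≤ n by omega)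
  unfold multinom
  rw [le_div_iff₀ (Finset.prod_pos fun v _ => by exact_mod_cast Nat.factorial_pos _)]
  rw [card_univ, Fintype.card_fin, ← h4]
  have : n.descFactorial (T.card - 1) * ∏ v, (countOn univ ψ v).factorial ≤
      (n - (T.card - 1)).factorial * n.descFactorial (T.card - 1) := by
    rw [mul_comm]; exact Nat.mul_le_mul_right _ hle
  exact_mod_cast this

lemma rpow_card_image_le_multinom (ψ : Fin n → V) (hn : 0 < n) (h2 : 2 ≤ (univ.image ψ).card) :
    (n : ℝ) ^ (((univ.image ψ).card : ℝ) / 4) ≤ multinom univ ψ := by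
  refine le_trans ?_ (descFactorial_le_multinom ψ hn)
  set r := (univ.image ψ).card with hr
  have hcard : r ≤ n := by simpa using Finset.card_image_le (s := univ) (f := ψ)
  have h := pow_le_descFactorial_sq (show r - 1 ≤ n by omega)
  have hn1 : (1 : ℝ) ≤ n := by exact_mod_cast hn
  refine le_of_sq_le_sq ?_ (by positivity)
  calc ((n : ℝ) ^ ((r : ℝ) / 4)) ^ 2 = (n : ℝ) ^ ((r : ℝ) / 2) := by
        rw [← Real.rpow_natCast, ← Real.rpow_mul (by positivity)]
        congr 1; push_cast; ring
    _ ≤ (n : ℝ) ^ (((r - 1 : ℕ) : ℝ)) := by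
        refine Real.rpow_le_rpow_of_exponent_le hn1 ?_
        have : (2 : ℝ) ≤ r := by exact_mod_cast h2
        rw [Nat.cast_sub (by omega)]
        push_cast; linarith
    _ ≤ _ := by
        rw [Real.rpow_natCast]
        exact_mod_cast h

lemma image_countOn (ψ : Fin n → V) : univ.image ψ = univ.filter fun v => countOn univ ψ v ≠ 0 := by
  ext v
  rw [← countOn_pos_iff]
  simp [Nat.pos_iff_ne_zero]

/-- The sum over the functions with at least two values of a negative power of the number of
their rearrangements. -/
lemma sum_multinom_rpow_le (hn : 0 < n) {κ : ℝ} (hκ : 1 ≤ κ) :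
    ∑ ψ : Fin n → V with 2 ≤ (univ.image ψ).card, multinom univ ψ ^ (-κ) ≤
      (1 + n * (n : ℝ) ^ (-((κ - 1) / 4))) ^ Fintype.card V - 1 := by
  have hn1 : (1 : ℝ) ≤ n := by exact_mod_cast hn
  set x : ℝ := (n : ℝ) ^ (-((κ - 1) / 4)) with hx
  have hx0 : 0 < x := Real.rpow_pos_of_pos (by positivity) _
  have hct : ∀ (ψ : Fin n → V) v, countOn univ ψ v < n + 1 := fun ψ v => by
    have := Finset.card_filter_le (univ : Finset (Fin n)) (fun i => ψ i = v)
    rw [card_univ, Fintype.card_fin] at this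
    exact Nat.lt_succ_of_le this
  let ty : (Fin n → V) → (V → Fin (n + 1)) := fun ψ v => ⟨countOn univ ψ v, hct ψ v⟩
  let w : (V → Fin (n + 1)) → ℝ := fun s => ∏ v, if s v = 0 then 1 else x
  have hw0 : ∀ s, 0 ≤ w s := fun s =>
    Finset.prod_nonneg fun v _ => by split_ifs <;> [norm_num; exact hx0.le]
  have hwty : ∀ ψ, w (ty ψ) = x ^ (univ.image ψ).card := by
    intro ψ
    simp only [w, ty, Finset.prod_ite, prod_const_one, one_mul, prod_const]
    rw [image_countOn]
    congr 2
    ext v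
    simp [Fin.ext_iff]
  have hterm : ∀ ψ : Fin n → V, 2 ≤ (univ.image ψ).card →
      multinom univ ψ ^ (-κ) ≤ (multinom univ ψ)⁻¹ * w (ty ψ) := by
    intro ψ h2
    have hM := multinom_pos (univ : Finset (Fin n)) ψ
    rw [show -κ = -1 + -(κ - 1) by ring, Real.rpow_add hM, Real.rpow_neg_one, hwty]
    refine mul_le_mul_of_nonneg_left ?_ (inv_nonneg.2 hM.le)
    calc multinom univ ψ ^ (-(κ - 1))
        ≤ ((n : ℝ) ^ (((univ.image ψ).card : ℝ) / 4)) ^ (-(κ - 1)) :=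
          Real.rpow_le_rpow_of_nonpos (Real.rpow_pos_of_pos (by positivity) _)
            (rpow_card_image_le_multinom ψ hn h2) (by linarith)
      _ = x ^ (univ.image ψ).card := by
          rw [hx, ← Real.rpow_natCast, ← Real.rpow_mul (by positivity),
            ← Real.rpow_mul (by positivity)]
          congr 1; ring
  have hfib : ∀ s : V → Fin (n + 1), ∑ ψ : Fin n → V with ty ψ = s, (multinom univ ψ)⁻¹ ≤ 1 := by
    intro s
    rcases (univ.filter fun ψ : Fin n → V => ty ψ = s).eq_empty_or_nonempty with h | ⟨ψ₀, h₀⟩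
    · rw [h]; simp
    · have h₀ := (mem_filter.1 h₀).2
      have hset : (univ.filter fun ψ : Fin n → V => ty ψ = s) = rearr univ ψ₀ := by
        ext ψ
        refine mem_filter.trans (Iff.trans ?_ mem_rearr.symm)
        simp only [← h₀, ty, funext_iff, Fin.ext_iff]
        simp
      rw [hset, Finset.sum_congr rfl (g := fun _ => (multinom univ ψ₀)⁻¹), sum_const, nsmul_eq_mul,
        card_rearr, mul_inv_cancel₀ (multinom_pos _ _).ne']
      intro ψ hψ
      rw [multinom_congr (mem_rearr.1 hψ).2]
  have hty0 : ∀ ψ, ty ψ ≠ 0 := by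
    intro ψ h
    have h2 := congrFun h (ψ ⟨0, hn⟩)
    have : 0 < countOn univ ψ (ψ ⟨0, hn⟩) :=
      countOn_pos_iff.2 (mem_image_of_mem _ (mem_univ _))
    simp only [ty, Fin.ext_iff] at h2
    simp at h2
    omega
  have htotal : ∑ s : V → Fin (n + 1), w s = (1 + n * x) ^ Fintype.card V := by
    have h1 : ∑ a : Fin (n + 1), (if a = 0 then (1 : ℝ) else x) = 1 + n * x := by
      rw [Fin.sum_univ_succ]
      simp
    simp only [w]
    rw [← Fintype.prod_sum (fun (_ : V) (a : Fin (n + 1)) => if a = 0 then (1 : ℝ) else x)]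
    simp [h1]
  calc ∑ ψ : Fin n → V with 2 ≤ (univ.image ψ).card, multinom univ ψ ^ (-κ)
      ≤ ∑ ψ : Fin n → V with 2 ≤ (univ.image ψ).card, (multinom univ ψ)⁻¹ * w (ty ψ) :=
        Finset.sum_le_sum fun ψ hψ => hterm ψ (mem_filter.1 hψ).2
    _ ≤ ∑ ψ : Fin n → V, (multinom univ ψ)⁻¹ * w (ty ψ) :=
        Finset.sum_le_sum_of_subset_of_nonneg (subset_univ _) fun ψ _ _ =>
          mul_nonneg (inv_nonneg.2 (multinom_pos _ _).le) (hw0 _)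
    _ = ∑ s ∈ univ.erase 0, ∑ ψ : Fin n → V with ty ψ = s, (multinom univ ψ)⁻¹ * w (ty ψ) :=
        (Finset.sum_fiberwise_of_maps_to
          (fun ψ _ => mem_erase.2 ⟨hty0 ψ, mem_univ _⟩) _).symm
    _ = ∑ s ∈ univ.erase 0, (∑ ψ : Fin n → V with ty ψ = s, (multinom univ ψ)⁻¹) * w s := by
        refine Finset.sum_congr rfl fun s _ => ?_
        rw [Finset.sum_mul]
        exact Finset.sum_congr rfl fun ψ hψ => by rw [(mem_filter.1 hψ).2]
    _ ≤ ∑ s ∈ univ.erase 0, w s :=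
        Finset.sum_le_sum fun s _ => mul_le_of_le_one_left (hw0 s) (hfib s)
    _ = _ := by
        rw [← htotal, ← Finset.add_sum_erase univ w (mem_univ 0)]
        simp [w]

end Types

section Shares

open Finset

variable {q : ℕ} [NeZero q] {n m : ℕ}

/-- The density of `m + 1` uniformly random shares that add up to `s`. -/
noncomputable def shareDensity (s : ZMod q) (v : Fin (m + 1) → ZMod q) : ℝ :=
  if ∑ t, v t = s then ((q : ℝ) ^ m)⁻¹ else 0

/-- The density of the shuffled shares of the parties' values `s`. -/
noncomputable def shuffledDensity (p : Fin (m + 1) → PMF (Equiv.Perm (Fin n)))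
    (s : Fin n → ZMod q) (w : Fin (m + 1) → Fin n → ZMod q) : ℝ :=
  ∑ π : Fin (m + 1) → Equiv.Perm (Fin n),
    (∏ t, (p t (π t)).toReal) * ∏ i, shareDensity (s i) fun t => w t (π t i)

lemma sum_stdAddChar_mul (b : ZMod q) :
    ∑ x : ZMod q, ZMod.stdAddChar (x * b) = if b = 0 then (q : ℂ) else 0 := by
  rw [AddChar.sum_mulShift b (ZMod.isPrimitive_stdAddChar q), ZMod.card]
  split_ifs <;> simp

lemma stdAddChar_sum {ι : Type} (A : Finset ι) (f : ι → ZMod q) :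
    ZMod.stdAddChar (∑ i ∈ A, f i) = ∏ i ∈ A, (ZMod.stdAddChar (f i) : ℂ) := by
  classical
  induction A using Finset.induction_on with
  | empty => simp
  | insert a A ha ih => rw [Finset.sum_insert ha, Finset.prod_insert ha, AddChar.map_add_eq_mul, ih]

lemma norm_stdAddChar (x : ZMod q) : ‖(ZMod.stdAddChar x : ℂ)‖ = 1 := by
  rw [ZMod.stdAddChar_apply]; exact Circle.norm_coe _

lemma shareDensity_eq (s : ZMod q) (v : Fin (m + 1) → ZMod q) :
    (shareDensity s v : ℂ) =
      ((q : ℂ) ^ (m + 1))⁻¹ * ∑ ψ : ZMod q, ZMod.stdAddChar (ψ * (s - ∑ t, v t)) := by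
  have hq : (q : ℂ) ≠ 0 := by exact_mod_cast NeZero.ne q
  rw [sum_stdAddChar_mul]
  unfold shareDensity
  have : s - ∑ t, v t = 0 ↔ ∑ t, v t = s := by rw [sub_eq_zero, eq_comm]
  simp only [this]
  split_ifs
  · push_cast; field_simp; ring
  · simp

lemma sum_char_mul_shareDensity (s : ZMod q) (b : Fin (m + 1) → ZMod q) :
    ∑ v : Fin (m + 1) → ZMod q, ZMod.stdAddChar (∑ t, b t * v t) * (shareDensity s v : ℂ) =
      ∑ ψ : ZMod q, if ∀ t, b t = ψ then (ZMod.stdAddChar (ψ * s) : ℂ) else 0 := by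
  have hq : (q : ℂ) ≠ 0 := by exact_mod_cast NeZero.ne q
  simp only [shareDensity_eq, Finset.mul_sum]
  rw [Finset.sum_comm]
  refine Finset.sum_congr rfl fun ψ _ => ?_
  have h1 : ∀ v : Fin (m + 1) → ZMod q, ZMod.stdAddChar (∑ t, b t * v t) *
      (((q : ℂ) ^ (m + 1))⁻¹ * ZMod.stdAddChar (ψ * (s - ∑ t, v t))) =
      ((q : ℂ) ^ (m + 1))⁻¹ * ZMod.stdAddChar (ψ * s) *
        ∏ t, ZMod.stdAddChar (v t * (b t - ψ)) := by
    intro v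
    have : (∑ t, b t * v t) + ψ * (s - ∑ t, v t) = ψ * s + ∑ t, v t * (b t - ψ) := by
      simp only [mul_sub, Finset.sum_sub_distrib, Finset.mul_sum]
      rw [Finset.sum_congr rfl fun t _ => mul_comm (b t) (v t),
        Finset.sum_congr rfl fun t _ => mul_comm ψ (v t)]
      ring
    rw [mul_left_comm, ← AddChar.map_add_eq_mul, this, AddChar.map_add_eq_mul, stdAddChar_sum,
      mul_assoc]
  rw [Finset.sum_congr rfl fun v _ => h1 v, ← Finset.mul_sum,
    ← Fintype.prod_sum (fun t (x : ZMod q) => (ZMod.stdAddChar (x * (b t - ψ)) : ℂ))]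
  simp only [sum_stdAddChar_mul, sub_eq_zero]
  rw [Finset.prod_ite_zero]
  simp only [mem_univ, true_implies, prod_const, card_univ, Fintype.card_fin]
  split_ifs
  · field_simp
  · simp

/-- Regrouping the shuffled messages by party. -/
def unshuffle (G : Type) (π : Fin (m + 1) → Equiv.Perm (Fin n)) :
    (Fin n → Fin (m + 1) → G) ≃ (Fin (m + 1) → Fin n → G) where
  toFun w' t k := w' ((π t).symm k) t
  invFun w i t := w t (π t i)
  left_inv w' := by ext; simp
  right_inv w := by ext; simp

lemma sum_char_mul_shuffledDensity (p : Fin (m + 1) → PMF (Equiv.Perm (Fin n)))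
    (s : Fin n → ZMod q) (a : Fin (m + 1) → Fin n → ZMod q) :
    ∑ w, ZMod.stdAddChar (∑ t, ∑ k, a t k * w t k) * (shuffledDensity p s w : ℂ) =
      ∑ ψ : Fin n → ZMod q, ZMod.stdAddChar (∑ i, ψ i * s i) *
        ((∏ t, matchProb (p t) (a t) ψ : ℝ) : ℂ) := by
  have hπ : ∀ π : Fin (m + 1) → Equiv.Perm (Fin n),
      ∑ w : Fin (m + 1) → Fin n → ZMod q, ZMod.stdAddChar (∑ t, ∑ k, a t k * w t k) *
        ((∏ i, shareDensity (s i) fun t => w t (π t i) : ℝ) : ℂ) =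
      ∑ ψ : Fin n → ZMod q, ZMod.stdAddChar (∑ i, ψ i * s i) *
        ((∏ t, (if a t ∘ π t = ψ then (1 : ℝ) else 0) : ℝ) : ℂ) := by
    intro π
    rw [← Equiv.sum_comp (unshuffle (ZMod q) π)]
    have h1 : ∀ w' : Fin n → Fin (m + 1) → ZMod q,
        ZMod.stdAddChar (∑ t, ∑ k, a t k * unshuffle (ZMod q) π w' t k) *
        ((∏ i, shareDensity (s i) fun t => unshuffle (ZMod q) π w' t (π t i) : ℝ) : ℂ) =
        ∏ i, (ZMod.stdAddChar (∑ t, a t (π t i) * w' i t) * (shareDensity (s i) (w' i) : ℂ)) := by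
      intro w'
      rw [Finset.prod_mul_distrib, ← stdAddChar_sum]
      push_cast
      congr 2
      · have hcomm : ∑ i, ∑ t, a t (π t i) * w' i t = ∑ t, ∑ i, a t (π t i) * w' i t :=
          Finset.sum_comm
        rw [hcomm]
        refine Finset.sum_congr rfl fun t _ => ?_
        rw [← Equiv.sum_comp (π t)]
        simp [unshuffle]
      · simp [unshuffle]
    rw [Finset.sum_congr rfl fun w' _ => h1 w', ← Fintype.prod_sum
      (fun i (v : Fin (m + 1) → ZMod q) =>
        (ZMod.stdAddChar (∑ t, a t (π t i) * v t) * (shareDensity (s i) v : ℂ)))]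
    simp only [sum_char_mul_shareDensity]
    rw [Fintype.prod_sum]
    refine Finset.sum_congr rfl fun ψ _ => ?_
    rw [Finset.prod_ite_zero, ← stdAddChar_sum, Finset.prod_ite_zero]
    have : (∀ i ∈ (univ : Finset (Fin n)), ∀ t, a t (π t i) = ψ i) ↔
        ∀ t ∈ (univ : Finset (Fin (m + 1))), a t ∘ π t = ψ := by
      simp only [mem_univ, true_implies, funext_iff, Function.comp_apply]
      exact forall_comm
    simp only [this]
    split_ifs <;> simp
  calc _ = ∑ w : Fin (m + 1) → Fin n → ZMod q,
        ∑ π : Fin (m + 1) → Equiv.Perm (Fin n), ((∏ t, (p t (π t)).toReal : ℝ) : ℂ) *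
        (ZMod.stdAddChar (∑ t, ∑ k, a t k * w t k) *
        ((∏ i, shareDensity (s i) fun t => w t (π t i) : ℝ) : ℂ)) := by
        refine Finset.sum_congr rfl fun w _ => ?_
        unfold shuffledDensity
        rw [Complex.ofReal_sum, Finset.mul_sum]
        refine Finset.sum_congr rfl fun π _ => ?_
        rw [Complex.ofReal_mul]
        ring
    _ = ∑ ψ : Fin n → ZMod q, ∑ π : Fin (m + 1) → Equiv.Perm (Fin n),
        ((∏ t, (p t (π t)).toReal : ℝ) : ℂ) * (ZMod.stdAddChar (∑ i, ψ i * s i) *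
        ((∏ t, (if a t ∘ π t = ψ then (1 : ℝ) else 0) : ℝ) : ℂ)) := by
        rw [Finset.sum_comm, Finset.sum_comm (s := (univ : Finset (Fin n → ZMod q)))]
        refine Finset.sum_congr rfl fun π _ => ?_
        rw [← Finset.mul_sum, hπ, Finset.mul_sum]
    _ = _ := by
        refine Finset.sum_congr rfl fun ψ _ => ?_
        unfold matchProb
        rw [Fintype.prod_sum (fun t (π : Equiv.Perm (Fin n)) =>
          (p t π).toReal * if a t ∘ π = ψ then (1 : ℝ) else 0), Complex.ofReal_sum, Finset.mul_sum]
        refine Finset.sum_congr rfl fun π _ => ?_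
        rw [Finset.prod_mul_distrib, Complex.ofReal_mul]
        ring

lemma sum_char_pairing (z : Fin m → Fin n → ZMod q) :
    ∑ a : Fin m → Fin n → ZMod q, (ZMod.stdAddChar (∑ t, ∑ k, a t k * z t k) : ℂ) =
      if z = 0 then (Fintype.card (Fin m → Fin n → ZMod q) : ℂ) else 0 := by
  simp only [stdAddChar_sum]
  rw [← Fintype.prod_sum (fun t (b : Fin n → ZMod q) =>
    ∏ k, (ZMod.stdAddChar (b k * z t k) : ℂ))]
  have : ∀ t, ∑ b : Fin n → ZMod q, ∏ k, (ZMod.stdAddChar (b k * z t k) : ℂ) =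
      ∏ k, if z t k = 0 then (q : ℂ) else 0 := by
    intro t
    rw [← Fintype.prod_sum (fun k (x : ZMod q) => (ZMod.stdAddChar (x * z t k) : ℂ))]
    simp only [sum_stdAddChar_mul]
  simp only [this, Finset.prod_ite_zero, mem_univ, true_implies]
  simp [funext_iff]

/-- Parseval's identity. -/
lemma sum_norm_sq_fourier (D : (Fin m → Fin n → ZMod q) → ℝ) :
    ∑ a : Fin m → Fin n → ZMod q,
      ‖∑ w, (ZMod.stdAddChar (∑ t, ∑ k, a t k * w t k) : ℂ) * (D w : ℂ)‖ ^ 2 =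
      Fintype.card (Fin m → Fin n → ZMod q) * ∑ w, D w ^ 2 := by
  have h : ∀ a : Fin m → Fin n → ZMod q,
      ((‖∑ w, (ZMod.stdAddChar (∑ t, ∑ k, a t k * w t k) : ℂ) * (D w : ℂ)‖ ^ 2 : ℝ) : ℂ) =
      ∑ w, ∑ w', (D w : ℂ) * (D w' : ℂ) *
        (ZMod.stdAddChar (∑ t, ∑ k, a t k * (w - w') t k) : ℂ) := by
    intro a
    rw [Complex.ofReal_pow, ← Complex.mul_conj', map_sum, Finset.sum_mul_sum]
    refine Finset.sum_congr rfl fun w _ => Finset.sum_congr rfl fun w' _ => ?_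
    rw [map_mul, Complex.conj_ofReal]
    have : (starRingEnd ℂ) (ZMod.stdAddChar (∑ t, ∑ k, a t k * w' t k)) =
        ZMod.stdAddChar (-∑ t, ∑ k, a t k * w' t k) := by
      rw [AddChar.map_neg_eq_inv, Complex.inv_eq_conj (norm_stdAddChar _)]
    rw [this]
    have h2 : ∑ t, ∑ k, a t k * (w - w') t k =
        ∑ t, ∑ k, a t k * w t k + -∑ t, ∑ k, a t k * w' t k := by
      simp only [Pi.sub_apply, mul_sub, Finset.sum_sub_distrib]
      ring
    rw [h2, AddChar.map_add_eq_mul]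
    ring
  have h2 : ((∑ a : Fin m → Fin n → ZMod q,
      ‖∑ w, (ZMod.stdAddChar (∑ t, ∑ k, a t k * w t k) : ℂ) * (D w : ℂ)‖ ^ 2 : ℝ) : ℂ) =
      ((Fintype.card (Fin m → Fin n → ZMod q) * ∑ w, D w ^ 2 : ℝ) : ℂ) := by
    rw [Complex.ofReal_sum, Finset.sum_congr rfl fun a _ => h a, Finset.sum_comm, Complex.ofReal_mul,
      Complex.ofReal_sum, Finset.mul_sum]
    refine Finset.sum_congr rfl fun w _ => ?_
    rw [Finset.sum_comm]
    simp only [← Finset.mul_sum, sum_char_pairing, sub_eq_zero]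
    simp
    ring
  exact_mod_cast h2

lemma sum_sq_sum_prod_matchProb_le {γ : ℝ} (hγ : 0 ≤ γ)
    {p : Fin (m + 1) → PMF (Equiv.Perm (Fin n))} (hp : ∀ t, IsImperfectShuffler γ (p t))
    (Ψ : Finset (Fin n → ZMod q)) :
    ∑ a : Fin (m + 1) → Fin n → ZMod q, (∑ ψ ∈ Ψ, ∏ t, matchProb (p t) (a t) ψ) ^ 2 ≤
      ∑ ψ ∈ Ψ, multinom univ ψ ^ (-(Real.exp (-γ) * m)) := by
  have hprod0 : ∀ (a : Fin (m + 1) → Fin n → ZMod q) ψ, 0 ≤ ∏ t, matchProb (p t) (a t) ψ :=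
    fun a ψ => Finset.prod_nonneg fun t _ => matchProb_nonneg _ _ _
  have hmain : ∀ (a : Fin (m + 1) → Fin n → ZMod q) (ψ : Fin n → ZMod q),
      (∑ ψ' ∈ Ψ, ∏ t, matchProb (p t) (a t) ψ') * ∏ t, matchProb (p t) (a t) ψ ≤
      multinom univ ψ ^ (-(Real.exp (-γ) * m)) * ∏ t, matchProb (p t) (a t) ψ := by
    intro a ψ
    rcases eq_or_ne (∏ t, matchProb (p t) (a t) ψ) 0 with h0 | h0
    · rw [h0]; simp
    refine mul_le_mul_of_nonneg_right ?_ (hprod0 a ψ)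
    have hM : ∀ t, multinom univ (a t) = multinom univ ψ := fun t =>
      multinom_congr (countOn_eq_of_matchProb_ne_zero
        (Finset.prod_ne_zero_iff.1 h0 t (mem_univ t)))
    calc ∑ ψ' ∈ Ψ, ∏ t, matchProb (p t) (a t) ψ'
        ≤ ∑ ψ', ∏ t, matchProb (p t) (a t) ψ' :=
          Finset.sum_le_sum_of_subset_of_nonneg (subset_univ _) fun ψ' _ _ => hprod0 a ψ'
      _ ≤ ∑ ψ', matchProb (p 0) (a 0) ψ' * (multinom univ ψ ^ (-Real.exp (-γ))) ^ m := by
          refine Finset.sum_le_sum fun ψ' _ => ?_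
          rw [Fin.prod_univ_succ]
          refine mul_le_mul_of_nonneg_left ?_ (matchProb_nonneg _ _ _)
          refine (Finset.prod_le_prod (fun t _ => matchProb_nonneg _ _ _)
            (fun t _ => matchProb_le hγ (hp _) (a (Fin.succ t)) ψ')).trans ?_
          simp [hM]
      _ = _ := by
          rw [← Finset.sum_mul, sum_matchProb_right, one_mul, ← Real.rpow_natCast,
            ← Real.rpow_mul (multinom_pos _ _).le]
          congr 1; ring
  calc _ = ∑ a : Fin (m + 1) → Fin n → ZMod q, ∑ ψ ∈ Ψ,
        (∑ ψ' ∈ Ψ, ∏ t, matchProb (p t) (a t) ψ') * ∏ t, matchProb (p t) (a t) ψ := by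
        refine Finset.sum_congr rfl fun a _ => ?_
        rw [sq, Finset.mul_sum]
    _ ≤ ∑ a : Fin (m + 1) → Fin n → ZMod q, ∑ ψ ∈ Ψ,
        multinom univ ψ ^ (-(Real.exp (-γ) * m)) * ∏ t, matchProb (p t) (a t) ψ :=
        Finset.sum_le_sum fun a _ => Finset.sum_le_sum fun ψ _ => hmain a ψ
    _ = _ := by
        rw [Finset.sum_comm]
        refine Finset.sum_congr rfl fun ψ _ => ?_
        rw [← Finset.mul_sum, ← Fintype.prod_sum (fun t f => matchProb (p t) f ψ)]
        simp [sum_matchProb_left]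

/-- The shuffled shares reveal little more than the sum of the parties' values. -/
lemma sq_sum_abs_shuffledDensity_sub_le {γ : ℝ} (hγ : 0 ≤ γ)
    {p : Fin (m + 1) → PMF (Equiv.Perm (Fin n))} (hp : ∀ t, IsImperfectShuffler γ (p t))
    {s s' : Fin n → ZMod q} (hs : ∑ i, s i = ∑ i, s' i) :
    (∑ w, |shuffledDensity p s w - shuffledDensity p s' w|) ^ 2 ≤
      4 * ∑ ψ : Fin n → ZMod q with 2 ≤ (univ.image ψ).card,
        multinom univ ψ ^ (-(Real.exp (-γ) * m)) := by
  set D : (Fin (m + 1) → Fin n → ZMod q) → ℝ :=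
    fun w => shuffledDensity p s w - shuffledDensity p s' w with hD
  set Ψ := univ.filter fun ψ : Fin n → ZMod q => 2 ≤ (univ.image ψ).card with hΨ
  have hfour : ∀ a : Fin (m + 1) → Fin n → ZMod q,
      ‖∑ w, (ZMod.stdAddChar (∑ t, ∑ k, a t k * w t k) : ℂ) * (D w : ℂ)‖ ≤
        2 * ∑ ψ ∈ Ψ, ∏ t, matchProb (p t) (a t) ψ := by
    intro a
    have h1 : ∑ w, (ZMod.stdAddChar (∑ t, ∑ k, a t k * w t k) : ℂ) * (D w : ℂ) =
        ∑ ψ : Fin n → ZMod q, (ZMod.stdAddChar (∑ i, ψ i * s i) -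
          ZMod.stdAddChar (∑ i, ψ i * s' i)) * ((∏ t, matchProb (p t) (a t) ψ : ℝ) : ℂ) := by
      simp only [hD, Complex.ofReal_sub, mul_sub, Finset.sum_sub_distrib, sub_mul,
        sum_char_mul_shuffledDensity]
    have h2 : ∀ ψ ∉ Ψ, (ZMod.stdAddChar (∑ i, ψ i * s i) -
          ZMod.stdAddChar (∑ i, ψ i * s' i) : ℂ) = 0 := by
      intro ψ hψ
      have hc : (univ.image ψ).card ≤ 1 := by
        simp only [hΨ, mem_filter, mem_univ, true_and] at hψ
        omega
      have hconst : ∀ i j, ψ i = ψ j := fun i j =>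
        Finset.card_le_one.1 hc _ (mem_image_of_mem _ (mem_univ _)) _
          (mem_image_of_mem _ (mem_univ _))
      have : ∑ i, ψ i * s i = ∑ i, ψ i * s' i := by
        rcases Nat.eq_zero_or_pos n with rfl | hn
        · simp
        · have h3 : ∀ i, ψ i = ψ ⟨0, hn⟩ := fun i => hconst i _
          generalize ψ ⟨0, hn⟩ = c at h3
          simp only [h3, ← Finset.mul_sum, hs]
      rw [this, sub_self]
    rw [h1, ← Finset.sum_subset (subset_univ Ψ) (fun ψ _ hψ => by rw [h2 ψ hψ, zero_mul])]
    refine (norm_sum_le _ _).trans ?_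
    rw [Finset.mul_sum]
    refine Finset.sum_le_sum fun ψ _ => ?_
    have h0 : 0 ≤ ∏ t, matchProb (p t) (a t) ψ :=
      Finset.prod_nonneg fun t _ => matchProb_nonneg _ _ _
    rw [norm_mul, Complex.norm_real, Real.norm_of_nonneg h0]
    refine mul_le_mul_of_nonneg_right ((norm_sub_le _ _).trans ?_) h0
    rw [norm_stdAddChar, norm_stdAddChar]; norm_num
  calc (∑ w, |D w|) ^ 2 ≤ Fintype.card (Fin (m + 1) → Fin n → ZMod q) * ∑ w, |D w| ^ 2 := by
        have := sq_sum_le_card_mul_sum_sq (s := univ) (f := fun w => |D w|)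
        rwa [card_univ] at this
    _ = ∑ a : Fin (m + 1) → Fin n → ZMod q,
        ‖∑ w, (ZMod.stdAddChar (∑ t, ∑ k, a t k * w t k) : ℂ) * (D w : ℂ)‖ ^ 2 := by
        rw [sum_norm_sq_fourier]; simp only [sq_abs]
    _ ≤ ∑ a : Fin (m + 1) → Fin n → ZMod q, (2 * ∑ ψ ∈ Ψ, ∏ t, matchProb (p t) (a t) ψ) ^ 2 :=
        Finset.sum_le_sum fun a _ => pow_le_pow_left₀ (norm_nonneg _) (hfour a) 2
    _ = 4 * ∑ a : Fin (m + 1) → Fin n → ZMod q, (∑ ψ ∈ Ψ, ∏ t, matchProb (p t) (a t) ψ) ^ 2 := by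
        rw [Finset.mul_sum]
        exact Finset.sum_congr rfl fun a _ => by ring
    _ ≤ _ := by
        refine mul_le_mul_of_nonneg_left (sum_sq_sum_prod_matchProb_le hγ hp Ψ) (by norm_num)

end Shares

section Noise

open Finset

open scoped ENNReal

lemma multichoose_add (r s : ℝ) (N : ℕ) :
    Ring.multichoose (r + s) N =
      ∑ ij ∈ antidiagonal N, Ring.multichoose r ij.1 * Ring.multichoose s ij.2 := by
  have h := Ring.add_choose_eq (r := -r) (s := -s) N (Commute.all _ _)
  have hc : ∀ (x : ℝ) k, Ring.choose (-x) k = (-1) ^ k * Ring.multichoose x k := by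
    intro x k
    rw [Ring.choose_neg', Int.negOnePow_def]
    simp [Units.smul_def]
  rw [← neg_add, hc] at h
  have h2 : ∀ ij ∈ antidiagonal N, Ring.choose (-r) ij.1 * Ring.choose (-s) ij.2 =
      (-1) ^ N * (Ring.multichoose r ij.1 * Ring.multichoose s ij.2) := by
    intro ij hij
    rw [hc, hc, ← mem_antidiagonal.1 hij, pow_add]; ring
  rw [Finset.sum_congr rfl h2, ← Finset.mul_sum] at h
  exact mul_left_cancel₀ (pow_ne_zero _ (by norm_num)) h

lemma multichoose_nonneg {r : ℝ} (hr : 0 ≤ r) (k : ℕ) : 0 ≤ Ring.multichoose r k := by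
  rcases hr.eq_or_lt with rfl | hr
  · cases k with
    | zero => simp
    | succ k => rw [Ring.multichoose_zero_succ]
  · have h := Ring.factorial_nsmul_multichoose_eq_ascPochhammer r k
    rw [Polynomial.ascPochhammer_smeval_eq_eval, nsmul_eq_mul] at h
    have h1 := ascPochhammer_pos k r hr
    rw [← h] at h1
    exact (pos_of_mul_pos_right h1 (by positivity)).le

/-- The weights of the negative binomial distribution with parameters `r` and `α`. -/
noncomputable def negBinomial (α r : ℝ) (k : ℕ) : ℝ≥0∞ :=
  ENNReal.ofReal ((1 - α) ^ r * (Ring.multichoose r k * α ^ k))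

variable {α : ℝ}

lemma negBinomial_add (hα : 0 < α) (hα1 : α < 1) {r s : ℝ} (hr : 0 ≤ r) (hs : 0 ≤ s) (N : ℕ) :
    negBinomial α (r + s) N =
      ∑ ij ∈ antidiagonal N, negBinomial α r ij.1 * negBinomial α s ij.2 := by
  have h0 : 0 < 1 - α := by linarith
  have hn : ∀ {r : ℝ}, 0 ≤ r → ∀ k : ℕ, 0 ≤ (1 - α) ^ r * (Ring.multichoose r k * α ^ k) :=
    fun {r} hr k => mul_nonneg (Real.rpow_pos_of_pos h0 r).le
      (mul_nonneg (multichoose_nonneg hr k) (by positivity))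
  unfold negBinomial
  rw [Finset.sum_congr rfl fun ij _ => (ENNReal.ofReal_mul (hn hr ij.1)).symm,
    ← ENNReal.ofReal_sum_of_nonneg fun ij _ => mul_nonneg (hn hr _) (hn hs _),
    multichoose_add, Real.rpow_add h0, Finset.sum_mul, Finset.mul_sum]
  congr 1
  refine Finset.sum_congr rfl fun ij hij => ?_
  rw [← mem_antidiagonal.1 hij, pow_add]; ring

lemma tsum_mul_add (u v H : ℕ → ℝ≥0∞) :
    ∑' a, ∑' b, u a * v b * H (a + b) =
      ∑' N, (∑ ij ∈ antidiagonal N, u ij.1 * v ij.2) * H N := by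
  rw [← ENNReal.tsum_prod (f := fun a b => u a * v b * H (a + b))]
  refine ((Finset.HasAntidiagonal.sigmaAntidiagonalEquivProd (A := ℕ)).tsum_eq
    (fun p => u p.1 * v p.2 * H (p.1 + p.2))).symm.trans ?_
  rw [ENNReal.tsum_sigma']
  refine tsum_congr fun N => ?_
  rw [tsum_fintype, Finset.sum_mul, ← Finset.sum_coe_sort (antidiagonal N) fun ij => u ij.1 * v ij.2 * H N]
  refine Finset.sum_congr rfl fun ij _ => ?_
  have h : ij.1.1 + ij.1.2 = N := mem_antidiagonal.1 ij.2
  change u ij.1.1 * v ij.1.2 * H (ij.1.1 + ij.1.2) = _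
  rw [h]

lemma tsum_negBinomial_add (hα : 0 < α) (hα1 : α < 1) {r s : ℝ} (hr : 0 ≤ r) (hs : 0 ≤ s)
    (H : ℕ → ℝ≥0∞) :
    ∑' a, ∑' b, negBinomial α r a * negBinomial α s b * H (a + b) =
      ∑' N, negBinomial α (r + s) N * H N := by
  rw [tsum_mul_add]
  exact tsum_congr fun N => by rw [negBinomial_add hα hα1 hr hs]

lemma negBinomial_zero (k : ℕ) : negBinomial α 0 k = if k = 0 then 1 else 0 := by
  cases k <;> simp [negBinomial, Ring.multichoose_zero_succ]

lemma negBinomial_one (k : ℕ) : negBinomial α 1 k = ENNReal.ofReal ((1 - α) * α ^ k) := by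
  simp [negBinomial, Ring.multichoose_one]

lemma tsum_negBinomial_one (hα : 0 < α) (hα1 : α < 1) : ∑' k, negBinomial α 1 k = 1 := by
  simp only [negBinomial_one]
  rw [← ENNReal.ofReal_tsum_of_nonneg (fun k => mul_nonneg (by linarith) (by positivity))
    ((summable_geometric_of_lt_one hα.le hα1).mul_left _), tsum_mul_left,
    tsum_geometric_of_lt_one hα.le hα1, mul_inv_cancel₀ (by linarith), ENNReal.ofReal_one]

lemma tsum_negBinomial (hα : 0 < α) (hα1 : α < 1) {n : ℕ} (hn : 0 < n) :
    ∑' k, negBinomial α (1 / n) k = 1 := by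
  set W : ℝ → ℝ≥0∞ := fun r => ∑' k, negBinomial α r k with hW
  have hmul : ∀ {r s : ℝ}, 0 ≤ r → 0 ≤ s → W (r + s) = W r * W s := by
    intro r s hr hs
    have h := tsum_negBinomial_add hα hα1 hr hs (fun _ => 1)
    simp only [mul_one, ENNReal.tsum_mul_left, ENNReal.tsum_mul_right] at h
    exact h.symm
  have hpow : ∀ k : ℕ, W (k * (1 / n)) = W (1 / n) ^ k := by
    intro k
    induction k with
    | zero => simp [hW, negBinomial_zero]
    | succ k ih =>
      rw [Nat.cast_succ, add_mul, one_mul, hmul (by positivity) (by positivity), ih, pow_succ]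
  have h := hpow n
  rw [mul_one_div_cancel (by positivity),
    show W 1 = 1 from tsum_negBinomial_one hα hα1] at h
  have h2 := congrArg ENNReal.toReal h
  rw [ENNReal.toReal_pow, ENNReal.toReal_one] at h2
  exact (ENNReal.toReal_eq_one_iff _).1
    ((pow_eq_one_iff_of_nonneg ENNReal.toReal_nonneg hn.ne').1 h2.symm)

/-- Expectation of `F (A - B)` for independent negative binomial variables `A` and `B`. -/
noncomputable def negBinomialDiff {G : Type} [AddCommGroupWithOne G] (α r : ℝ) (F : G → ℝ≥0∞) :
    ℝ≥0∞ :=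
  ∑' A : ℕ, ∑' B : ℕ, negBinomial α r A * negBinomial α r B * F ((A : G) - B)

lemma negBinomialDiff_add {G : Type} [AddCommGroupWithOne G] (hα : 0 < α) (hα1 : α < 1)
    {r s : ℝ} (hr : 0 ≤ r) (hs : 0 ≤ s) (F : G → ℝ≥0∞) :
    negBinomialDiff α (r + s) F =
      negBinomialDiff α r fun x => negBinomialDiff α s fun y => F (x + y) := by
  unfold negBinomialDiff
  symm
  calc _ = ∑' a : ℕ, ∑' b : ℕ, ∑' A : ℕ, ∑' B : ℕ, negBinomial α r a * negBinomial α s A *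
        (negBinomial α r b * negBinomial α s B * F (((a + A : ℕ) : G) - ((b + B : ℕ) : G))) := by
        simp only [← ENNReal.tsum_mul_left]
        refine tsum_congr fun a => tsum_congr fun b => tsum_congr fun A => tsum_congr fun B => ?_
        rw [show (((a + A : ℕ) : G) - ((b + B : ℕ) : G)) = (a : G) - b + ((A : G) - B) by
          push_cast; abel]
        ring
    _ = ∑' a : ℕ, ∑' A : ℕ, ∑' b : ℕ, ∑' B : ℕ, negBinomial α r a * negBinomial α s A *
        (negBinomial α r b * negBinomial α s B * F (((a + A : ℕ) : G) - ((b + B : ℕ) : G))) :=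
        tsum_congr fun a => ENNReal.tsum_comm
    _ = ∑' a : ℕ, ∑' A : ℕ, negBinomial α r a * negBinomial α s A *
        ∑' N : ℕ, negBinomial α (r + s) N * F (((a + A : ℕ) : G) - (N : G)) := by
        refine tsum_congr fun a => tsum_congr fun A => ?_
        simp only [ENNReal.tsum_mul_left]
        rw [tsum_negBinomial_add hα hα1 hr hs (fun N => F (((a + A : ℕ) : G) - (N : G)))]
    _ = _ := by
        rw [tsum_negBinomial_add hα hα1 hr hs
          (fun M => ∑' N : ℕ, negBinomial α (r + s) N * F ((M : G) - (N : G)))]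
        refine tsum_congr fun M => ?_
        rw [← ENNReal.tsum_mul_left]
        exact tsum_congr fun N => by rw [mul_assoc]

lemma mul_negBinomialDiff_one_le {G : Type} [AddCommGroupWithOne G] (hα : 0 < α) (F : G → ℝ≥0∞) :
    ENNReal.ofReal α * negBinomialDiff α 1 (fun x => F (x + 1)) ≤ negBinomialDiff α 1 F ∧
    ENNReal.ofReal α * negBinomialDiff α 1 (fun x => F (x - 1)) ≤ negBinomialDiff α 1 F := by
  have hs : ∀ k, ENNReal.ofReal α * negBinomial α 1 k = negBinomial α 1 (k + 1) := by
    intro k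
    rw [negBinomial_one, negBinomial_one, ← ENNReal.ofReal_mul hα.le]
    congr 1; ring
  unfold negBinomialDiff
  constructor
  · rw [← ENNReal.tsum_mul_left]
    refine le_trans (le_of_eq (tsum_congr fun A => ?_)) (ENNReal.tsum_comp_le_tsum_of_injective
      (add_left_injective 1) (fun A : ℕ => ∑' B : ℕ, negBinomial α 1 A * negBinomial α 1 B *
        F ((A : G) - B)))
    rw [← ENNReal.tsum_mul_left]
    refine tsum_congr fun B => ?_
    rw [← hs]
    push_cast
    rw [add_sub_right_comm]
    ring
  · rw [← ENNReal.tsum_mul_left]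
    refine ENNReal.tsum_le_tsum fun A => ?_
    rw [← ENNReal.tsum_mul_left]
    refine le_trans (le_of_eq (tsum_congr fun B => ?_)) (ENNReal.tsum_comp_le_tsum_of_injective
      (add_left_injective 1) (fun B : ℕ => negBinomial α 1 A * negBinomial α 1 B *
        F ((A : G) - B)))
    simp only []
    rw [← hs]
    push_cast
    rw [sub_add_eq_sub_sub]
    ring

lemma pow_natAbs_mul_negBinomialDiff_le {G : Type} [AddCommGroupWithOne G] (hα : 0 < α) (k : ℤ)
    (F : G → ℝ≥0∞) :
    ENNReal.ofReal α ^ k.natAbs * negBinomialDiff α 1 (fun x => F (x + k)) ≤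
      negBinomialDiff α 1 F := by
  have hpos : ∀ (j : ℕ) (F : G → ℝ≥0∞),
      ENNReal.ofReal α ^ j * negBinomialDiff α 1 (fun x => F (x + j)) ≤ negBinomialDiff α 1 F := by
    intro j
    induction j with
    | zero => simp
    | succ j ih =>
      intro F
      refine le_trans ?_ (ih F)
      rw [pow_succ, mul_assoc]
      gcongr
      refine le_trans (le_of_eq ?_) (mul_negBinomialDiff_one_le hα (fun x => F (x + j))).1
      congr! 3 with x
      rw [Nat.cast_succ]
      congr 1
      abel
  have hneg : ∀ (j : ℕ) (F : G → ℝ≥0∞),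
      ENNReal.ofReal α ^ j * negBinomialDiff α 1 (fun x => F (x - j)) ≤ negBinomialDiff α 1 F := by
    intro j
    induction j with
    | zero => simp
    | succ j ih =>
      intro F
      refine le_trans ?_ (ih F)
      rw [pow_succ, mul_assoc]
      gcongr
      refine le_trans (le_of_eq ?_) (mul_negBinomialDiff_one_le hα (fun x => F (x - j))).2
      congr! 3 with x
      rw [Nat.cast_succ]
      congr 1
      abel
  obtain ⟨j, rfl | rfl⟩ := k.eq_nat_or_neg
  · simpa using hpos j F
  · simpa [sub_eq_add_neg] using hneg j F

lemma tsum_negBinomial_one_mul (hα : 0 < α) (hα1 : α < 1) :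
    ∑' k : ℕ, negBinomial α 1 k * k = ENNReal.ofReal (α / (1 - α)) := by
  have h1 : ∀ k : ℕ, negBinomial α 1 k * k = ENNReal.ofReal ((1 - α) * (k * α ^ k)) := by
    intro k
    rw [negBinomial_one, ← ENNReal.ofReal_natCast, ← ENNReal.ofReal_mul
      (mul_nonneg (by linarith) (by positivity))]
    congr 1; ring
  have hα' : ‖α‖ < 1 := by rwa [Real.norm_of_nonneg hα.le]
  have hsum : Summable fun k : ℕ => (k : ℝ) * α ^ k := by
    simpa using summable_pow_mul_geometric_of_norm_lt_one 1 hα'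
  simp only [h1]
  rw [← ENNReal.ofReal_tsum_of_nonneg
    (fun k => mul_nonneg (by linarith) (by positivity)) (hsum.mul_left _), tsum_mul_left,
    tsum_coe_mul_geometric_of_norm_lt_one hα']
  congr 1
  have : 1 - α ≠ 0 := by linarith
  field_simp

lemma negBinomialDiff_le {G : Type} [AddCommGroupWithOne G] (hα : 0 < α) (hα1 : α < 1)
    (F : G → ℝ≥0∞) (c c' : ℝ≥0∞) (hF : ∀ j : ℤ, F j ≤ c * j.natAbs + c') :
    negBinomialDiff α 1 F ≤ c * ENNReal.ofReal (2 * (α / (1 - α))) + c' := by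
  set w := negBinomial α 1 with hw
  have h1 : ∑' k, w k = 1 := tsum_negBinomial_one hα hα1
  have h2 : ∑' k : ℕ, w k * k = ENNReal.ofReal (α / (1 - α)) := tsum_negBinomial_one_mul hα hα1
  have hd : 0 ≤ α / (1 - α) := div_nonneg hα.le (by linarith)
  calc negBinomialDiff α 1 F ≤ ∑' A : ℕ, ∑' B : ℕ,
        (c * (w B * (w A * A)) + c * (w A * (w B * B)) + c' * (w A * w B)) := by
        refine ENNReal.tsum_le_tsum fun A => ENNReal.tsum_le_tsum fun B => ?_
        have h3 : F ((A : G) - B) ≤ c * (A + B) + c' := by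
          have h4 := hF ((A : ℤ) - B)
          push_cast at h4
          refine h4.trans ?_
          gcongr
          have : ((A : ℤ) - B).natAbs ≤ A + B := by omega
          exact_mod_cast this
        calc w A * w B * F ((A : G) - B) ≤ w A * w B * (c * (A + B) + c') := by gcongr
          _ = _ := by ring
    _ = _ := by
        simp only [ENNReal.tsum_add, ENNReal.tsum_mul_left, ENNReal.tsum_mul_right, h1, h2]
        rw [two_mul, ENNReal.ofReal_add hd hd]
        ring

/-- The negative binomial distribution with parameters `1 / n` and `α`. -/
noncomputable def negBinomialPMF (hα : 0 < α) (hα1 : α < 1) {n : ℕ} (hn : 0 < n) : PMF ℕ :=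
  ⟨negBinomial α (1 / n), by
    rw [← tsum_negBinomial hα hα1 hn]; exact ENNReal.summable.hasSum⟩

lemma negBinomialPMF_apply (hα : 0 < α) (hα1 : α < 1) {n : ℕ} (hn : 0 < n) (k : ℕ) :
    negBinomialPMF hα hα1 hn k = negBinomial α (1 / n) k := rfl

/-- The distribution of the difference of two independent negative binomial variables in `ZMod q`. -/
noncomputable def noisePMF (q : ℕ) (hα : 0 < α) (hα1 : α < 1) {n : ℕ} (hn : 0 < n) :
    PMF (ZMod q) :=
  (negBinomialPMF hα hα1 hn).bind fun A : ℕ =>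
    (negBinomialPMF hα hα1 hn).map fun B : ℕ => (A : ZMod q) - (B : ZMod q)

variable {q : ℕ} [NeZero q]

lemma sum_noisePMF_mul (hα : 0 < α) (hα1 : α < 1) {n : ℕ} (hn : 0 < n) (F : ZMod q → ℝ≥0∞) :
    ∑ x, noisePMF q hα hα1 hn x * F x = negBinomialDiff α (1 / n) F := by
  unfold noisePMF negBinomialDiff
  simp only [PMF.bind_apply, PMF.map_apply, negBinomialPMF_apply]
  simp only [← ENNReal.tsum_mul_left, ← ENNReal.tsum_mul_right]
  refine (tsum_fintype (L := SummationFilter.unconditional (ZMod q)) _).symm.trans ?_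
  refine ENNReal.tsum_comm.trans (tsum_congr fun A => ?_)
  refine ENNReal.tsum_comm.trans (tsum_congr fun B => ?_)
  refine (tsum_eq_single ((A : ZMod q) - B) fun x hx => ?_).trans ?_
  · simp [hx]
  · simp

lemma sum_prod_noisePMF_mul (hα : 0 < α) (hα1 : α < 1) {n : ℕ} (hn : 0 < n) (k : ℕ) :
    ∀ F : ZMod q → ℝ≥0∞,
    ∑ η : Fin k → ZMod q, (∏ i, noisePMF q hα hα1 hn (η i)) * F (∑ i, η i) =
      negBinomialDiff α (k * (1 / n)) F := by
  induction k with
  | zero =>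
    intro F
    have : ∀ A B : ℕ, negBinomial α 0 A * negBinomial α 0 B * F ((A : ZMod q) - B) =
        if B = 0 then (if A = 0 then F 0 else 0) else 0 := by
      intro A B
      rw [negBinomial_zero, negBinomial_zero]
      split_ifs with h1 h2 h2 <;> simp [*]
    simp [negBinomialDiff, this]
  | succ k ih =>
    intro F
    rw [← Equiv.sum_comp (Fin.consEquiv fun _ : Fin (k + 1) => ZMod q), Fintype.sum_prod_type,
      Nat.cast_succ, add_mul, one_mul, add_comm ((k : ℝ) * _),
      negBinomialDiff_add hα hα1 (by positivity) (by positivity), ← sum_noisePMF_mul hα hα1 hn]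
    refine Finset.sum_congr rfl fun x _ => ?_
    rw [← ih, Finset.mul_sum]
    refine Finset.sum_congr rfl fun η _ => ?_
    simp [Fin.consEquiv, Fin.prod_univ_succ, Fin.sum_univ_succ, mul_assoc]

lemma ofReal_sum_prod_noisePMF (hα : 0 < α) (hα1 : α < 1) {n : ℕ} (hn : 0 < n)
    (F : ZMod q → ℝ) (hF : ∀ x, 0 ≤ F x) :
    ENNReal.ofReal (∑ η : Fin n → ZMod q,
      (∏ i, (noisePMF q hα hα1 hn (η i)).toReal) * F (∑ i, η i)) =
      negBinomialDiff α 1 fun x => ENNReal.ofReal (F x) := by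
  have h := sum_prod_noisePMF_mul hα hα1 hn n (fun x : ZMod q => ENNReal.ofReal (F x))
  rw [mul_one_div_cancel (by positivity)] at h
  rw [← h, ENNReal.ofReal_sum_of_nonneg fun η _ =>
    mul_nonneg (Finset.prod_nonneg fun i _ => ENNReal.toReal_nonneg) (hF _)]
  refine Finset.sum_congr rfl fun η _ => ?_
  rw [ENNReal.ofReal_mul (Finset.prod_nonneg fun i _ => ENNReal.toReal_nonneg),
    ENNReal.ofReal_prod_of_nonneg fun i _ => ENNReal.toReal_nonneg]
  congr 1
  exact Finset.prod_congr rfl fun i _ => ENNReal.ofReal_toReal ((noisePMF q hα hα1 hn).apply_ne_top _)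

/-- Shifting the sum of the noise of all parties changes expectations by a bounded factor. -/
lemma noise_shift_le (hα : 0 < α) (hα1 : α < 1) {n : ℕ} (hn : 0 < n)
    (F : ZMod q → ℝ) (hF : ∀ x, 0 ≤ F x) (k : ℤ) :
    α ^ k.natAbs * ∑ η : Fin n → ZMod q,
      (∏ i, (noisePMF q hα hα1 hn (η i)).toReal) * F (∑ i, η i + (k : ZMod q)) ≤
    ∑ η : Fin n → ZMod q, (∏ i, (noisePMF q hα hα1 hn (η i)).toReal) * F (∑ i, η i) := by
  have hnn : 0 ≤ ∑ η : Fin n → ZMod q,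
      (∏ i, (noisePMF q hα hα1 hn (η i)).toReal) * F (∑ i, η i) :=
    Finset.sum_nonneg fun η _ =>
      mul_nonneg (Finset.prod_nonneg fun i _ => ENNReal.toReal_nonneg) (hF _)
  rw [← ENNReal.ofReal_le_ofReal_iff hnn, ENNReal.ofReal_mul (by positivity),
    ENNReal.ofReal_pow hα.le, ofReal_sum_prod_noisePMF hα hα1 hn F hF,
    ofReal_sum_prod_noisePMF hα hα1 hn (fun x => F (x + (k : ZMod q))) (fun x => hF _)]
  exact pow_natAbs_mul_negBinomialDiff_le hα k (fun x => ENNReal.ofReal (F x))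

lemma noise_expectation_le (hα : 0 < α) (hα1 : α < 1) {n : ℕ} (hn : 0 < n)
    (F : ZMod q → ℝ) (hF : ∀ x, 0 ≤ F x) {c c' : ℝ} (hc : 0 ≤ c) (hc' : 0 ≤ c')
    (h : ∀ j : ℤ, F j ≤ c * j.natAbs + c') :
    ∑ η : Fin n → ZMod q, (∏ i, (noisePMF q hα hα1 hn (η i)).toReal) * F (∑ i, η i) ≤
      c * (2 * (α / (1 - α))) + c' := by
  have hd : 0 ≤ 2 * (α / (1 - α)) := mul_nonneg (by norm_num) (div_nonneg hα.le (by linarith))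
  rw [← ENNReal.ofReal_le_ofReal_iff (by positivity), ofReal_sum_prod_noisePMF hα hα1 hn F hF,
    ENNReal.ofReal_add (by positivity) hc', ENNReal.ofReal_mul hc]
  refine negBinomialDiff_le hα hα1 _ _ _ fun j => ?_
  refine (ENNReal.ofReal_le_ofReal (h j)).trans (le_of_eq ?_)
  rw [ENNReal.ofReal_add (by positivity) hc', ENNReal.ofReal_mul hc, ENNReal.ofReal_natCast]

end Noise

section View

open Finset

variable {q : ℕ} [NeZero q] {n m d : ℕ}

lemma shareDensity_nonneg (s : ZMod q) (v : Fin (m + 1) → ZMod q) : 0 ≤ shareDensity s v := by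
  unfold shareDensity; split_ifs <;> positivity

lemma sum_shareDensity (s : ZMod q) : ∑ v : Fin (m + 1) → ZMod q, shareDensity s v = 1 := by
  have h := sum_char_mul_shareDensity s (0 : Fin (m + 1) → ZMod q)
  have h1 : ∀ ψ : ZMod q, (∀ t : Fin (m + 1), (0 : Fin (m + 1) → ZMod q) t = ψ) ↔ ψ = 0 := by
    intro ψ; simp [eq_comm]
  simp only [h1] at h
  simp at h
  exact_mod_cast h

lemma shuffledDensity_nonneg (p : Fin (m + 1) → PMF (Equiv.Perm (Fin n)))
    (s : Fin n → ZMod q) (w : Fin (m + 1) → Fin n → ZMod q) : 0 ≤ shuffledDensity p s w :=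
  Finset.sum_nonneg fun _ _ => mul_nonneg (Finset.prod_nonneg fun _ _ => ENNReal.toReal_nonneg)
    (Finset.prod_nonneg fun _ _ => shareDensity_nonneg _ _)

lemma sum_prod_toReal {ι α : Type} [Fintype ι] [DecidableEq ι] [Fintype α] (p : ι → PMF α) :
    ∑ f : ι → α, ∏ i, (p i (f i)).toReal = 1 := by
  rw [← Fintype.prod_sum (fun i a => (p i a).toReal)]
  simp [PMF.sum_toReal]

lemma sum_shuffledDensity (p : Fin (m + 1) → PMF (Equiv.Perm (Fin n))) (s : Fin n → ZMod q) :
    ∑ w, shuffledDensity p s w = 1 := by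
  unfold shuffledDensity
  rw [Finset.sum_comm, ← sum_prod_toReal p]
  refine Finset.sum_congr rfl fun π _ => ?_
  rw [← Finset.mul_sum, ← Equiv.sum_comp (unshuffle (ZMod q) π)]
  have : ∑ w' : Fin n → Fin (m + 1) → ZMod q,
      ∏ i, shareDensity (s i) (fun t => unshuffle (ZMod q) π w' t (π t i)) = 1 := by
    calc _ = ∑ w' : Fin n → Fin (m + 1) → ZMod q, ∏ i, shareDensity (s i) (w' i) := by
          simp [unshuffle]
      _ = 1 := by
          rw [← Fintype.prod_sum (fun i (v : Fin (m + 1) → ZMod q) => shareDensity (s i) v)]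
          simp [sum_shareDensity]
  rw [this, mul_one]

lemma shuffledDensity_mul_apply_sum (p : Fin (m + 1) → PMF (Equiv.Perm (Fin n)))
    (s : Fin n → ZMod q) (w : Fin (m + 1) → Fin n → ZMod q) (h : ZMod q → ℝ) :
    shuffledDensity p s w * h (∑ t, ∑ k, w t k) = shuffledDensity p s w * h (∑ i, s i) := by
  rcases eq_or_ne (shuffledDensity p s w) 0 with h0 | h0
  · simp [h0]
  obtain ⟨π, -, hπ⟩ := Finset.exists_ne_zero_of_sum_ne_zero h0
  have h1 := Finset.prod_ne_zero_iff.1 (right_ne_zero_of_mul hπ)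
  have h2 : ∀ i, ∑ t, w t (π t i) = s i := by
    intro i
    by_contra hne
    exact h1 i (mem_univ i) (by simp [shareDensity, hne])
  have h3 : ∑ t, ∑ k, w t k = ∑ i, s i := by
    calc ∑ t, ∑ k, w t k = ∑ t, ∑ i, w t (π t i) :=
          Finset.sum_congr rfl fun t _ => (Equiv.sum_comp (π t) _).symm
      _ = ∑ i, ∑ t, w t (π t i) := Finset.sum_comm
      _ = _ := Finset.sum_congr rfl fun i _ => h2 i
  rw [h3]

/-- The distribution of `m + 1` uniformly random shares that add up to `s`. -/
noncomputable def sharePMF (m : ℕ) (s : ZMod q) : PMF (Fin (m + 1) → ZMod q) :=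
  PMF.ofFintype (fun v => ENNReal.ofReal (shareDensity s v)) (by
    rw [← ENNReal.ofReal_sum_of_nonneg fun v _ => shareDensity_nonneg s v, sum_shareDensity,
      ENNReal.ofReal_one])

/-- The distribution of the shares of `z` plus noise. -/
noncomputable def noisySharePMF (ν : PMF (ZMod q)) (m : ℕ) (z : ZMod q) :
    PMF (Fin (m + 1) → ZMod q) :=
  ν.bind fun η => sharePMF m (z + η)

lemma noisySharePMF_toReal (ν : PMF (ZMod q)) (z : ZMod q) (v : Fin (m + 1) → ZMod q) :
    (noisySharePMF ν m z v).toReal = ∑ η, (ν η).toReal * shareDensity (z + η) v := by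
  unfold noisySharePMF
  rw [PMF.bind_apply, tsum_fintype, ENNReal.toReal_sum fun η _ =>
    ENNReal.mul_ne_top (ν.apply_ne_top _) (PMF.apply_ne_top _ _)]
  refine Finset.sum_congr rfl fun η _ => ?_
  rw [ENNReal.toReal_mul, sharePMF, PMF.ofFintype_apply,
    ENNReal.toReal_ofReal (shareDensity_nonneg _ _)]

/-- The density of the shuffled shares of the parties' values `z` plus noise. -/
noncomputable def noisyDensity (ν : PMF (ZMod q)) (p : Fin (m + 1) → PMF (Equiv.Perm (Fin n)))
    (z : Fin n → ZMod q) (w : Fin (m + 1) → Fin n → ZMod q) : ℝ :=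
  ∑ η : Fin n → ZMod q, (∏ i, (ν (η i)).toReal) * shuffledDensity p (z + η) w

lemma sum_shuffle_noisySharePMF (ν : PMF (ZMod q)) (p : Fin (m + 1) → PMF (Equiv.Perm (Fin n)))
    (z : Fin n → ZMod q) (w : Fin (m + 1) → Fin n → ZMod q) :
    ∑ π : Fin (m + 1) → Equiv.Perm (Fin n), (∏ t, (p t (π t)).toReal) *
      ∏ i, (noisySharePMF ν m (z i) fun t => w t (π t i)).toReal = noisyDensity ν p z w := by
  unfold noisyDensity shuffledDensity
  simp only [noisySharePMF_toReal]
  simp only [Fintype.prod_sum, Finset.mul_sum]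
  rw [Finset.sum_comm]
  refine Finset.sum_congr rfl fun η _ => Finset.sum_congr rfl fun π _ => ?_
  rw [Finset.prod_mul_distrib]
  simp only [Pi.add_apply]
  ring

lemma ShuffleProtocol.view_toReal {X M Y : Type} [Fintype M]
    (P : ShuffleProtocol X M Y n m) (S : Fin m → PMF (Equiv.Perm (Fin n))) (x : Fin n → X)
    (v : Fin m → Fin n → M) :
    (P.view S x v).toReal = ∑ π : Fin m → Equiv.Perm (Fin n), (∏ j, (S j (π j)).toReal) *
      ∏ i, (P.randomizer (x i) fun j => v j (π j i)).toReal := by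
  classical
  have h : P.view S x v = ∑ π : Fin m → Equiv.Perm (Fin n), (∏ j, S j (π j)) *
      ∏ i, P.randomizer (x i) fun j => v j (π j i) := by
    unfold ShuffleProtocol.view
    rw [PMF.bind_apply, tsum_fintype]
    simp only [PMF.map_apply, tsum_fintype, Finset.mul_sum, indepPMF, PMF.ofFintype_apply]
    rw [Finset.sum_comm]
    refine Finset.sum_congr rfl fun π _ => ?_
    have hiff : ∀ msg : Fin n → Fin m → M, (v = fun j k => msg ((π j).symm k) j) ↔
        msg = fun i j => v j (π j i) := by
      intro msg
      constructor
      · rintro rfl; ext i j; simp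
      · rintro rfl; ext j k; simp
    simp only [hiff, mul_ite, mul_zero]
    rw [Finset.sum_ite_eq' univ (fun i j => v j (π j i))]
    simp [mul_comm]
  rw [h, ENNReal.toReal_sum fun π _ => ENNReal.mul_ne_top
    (ENNReal.prod_ne_top fun j _ => PMF.apply_ne_top _ _)
    (ENNReal.prod_ne_top fun j _ => PMF.apply_ne_top _ _)]
  simp only [ENNReal.toReal_mul, ENNReal.toReal_prod]

/-- The rounds that belong to one coordinate of the input. -/
def splitRounds (A : Type) : (Fin (d * (m + 1)) → A) ≃ (Fin d → Fin (m + 1) → A) :=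
  (Equiv.arrowCongr finProdFinEquiv.symm (Equiv.refl A)).trans (Equiv.curry _ _ _)

/-- Vector summation by shares: in each coordinate, every party encodes its entry in `ZMod q`,
adds noise and splits the result into shares; the analyzer adds all shares. -/
noncomputable def vectorSum (ν : PMF (ZMod q)) (n m d : ℕ) :
    ShuffleProtocol (Fin d → Set.Icc (0 : ℝ) 1) (ZMod q) (Fin d → ℝ) n (d * (m + 1)) where
  randomizer x := (indepPMF fun c => noisySharePMF ν m (⌊(n : ℝ) * (x c : ℝ)⌋₊ : ZMod q)).map
    (splitRounds (ZMod q)).symm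
  analyzer v c := ((∑ t, ∑ k, splitRounds (Fin n → ZMod q) v c t k).valMinAbs : ℝ) / n

lemma vectorSum_randomizer_toReal (ν : PMF (ZMod q)) (x : Fin d → Set.Icc (0 : ℝ) 1)
    (w : Fin (d * (m + 1)) → ZMod q) :
    ((vectorSum ν n m d).randomizer x w).toReal =
      ∏ c, (noisySharePMF ν m (⌊(n : ℝ) * (x c : ℝ)⌋₊ : ZMod q) (splitRounds _ w c)).toReal := by
  classical
  have h : ∀ u : Fin d → Fin (m + 1) → ZMod q,
      w = (splitRounds (ZMod q)).symm u ↔ u = splitRounds _ w := by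
    intro u; rw [Equiv.eq_symm_apply, eq_comm]
  simp only [vectorSum, PMF.map_apply, tsum_fintype, h, indepPMF, PMF.ofFintype_apply]
  rw [Finset.sum_ite_eq' univ (splitRounds _ w)]
  simp [ENNReal.toReal_prod]

lemma vectorSum_view_toReal (ν : PMF (ZMod q)) (S : Fin (d * (m + 1)) → PMF (Equiv.Perm (Fin n)))
    (x : Fin n → Fin d → Set.Icc (0 : ℝ) 1) (v : Fin (d * (m + 1)) → Fin n → ZMod q) :
    ((vectorSum ν n m d).view S x v).toReal =
      ∏ c, noisyDensity ν (splitRounds _ S c) (fun i => (⌊(n : ℝ) * (x i c : ℝ)⌋₊ : ZMod q))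
        (splitRounds _ v c) := by
  rw [ShuffleProtocol.view_toReal]
  simp only [← sum_shuffle_noisySharePMF]
  rw [Fintype.prod_sum, ← Equiv.sum_comp (splitRounds (Equiv.Perm (Fin n)))]
  refine Finset.sum_congr rfl fun π _ => ?_
  rw [Finset.prod_mul_distrib]
  congr 1
  · rw [← Equiv.prod_comp finProdFinEquiv, Fintype.prod_prod_type]
    rfl
  · simp only [vectorSum_randomizer_toReal]
    rw [Finset.prod_comm]
    rfl

lemma noisyDensity_nonneg (ν : PMF (ZMod q)) (p : Fin (m + 1) → PMF (Equiv.Perm (Fin n)))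
    (z : Fin n → ZMod q) (w : Fin (m + 1) → Fin n → ZMod q) : 0 ≤ noisyDensity ν p z w :=
  Finset.sum_nonneg fun _ _ => mul_nonneg (Finset.prod_nonneg fun _ _ => ENNReal.toReal_nonneg)
    (shuffledDensity_nonneg _ _ _)

lemma sum_noisyDensity (ν : PMF (ZMod q)) (p : Fin (m + 1) → PMF (Equiv.Perm (Fin n)))
    (z : Fin n → ZMod q) : ∑ w, noisyDensity ν p z w = 1 := by
  unfold noisyDensity
  rw [Finset.sum_comm, ← sum_prod_toReal (fun _ : Fin n => ν)]
  refine Finset.sum_congr rfl fun η _ => ?_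
  rw [← Finset.mul_sum, sum_shuffledDensity, mul_one]

lemma sum_noisyDensity_mul (ν : PMF (ZMod q)) (p : Fin (m + 1) → PMF (Equiv.Perm (Fin n)))
    (z : Fin n → ZMod q) (h : ZMod q → ℝ) :
    ∑ w, noisyDensity ν p z w * h (∑ t, ∑ k, w t k) =
      ∑ η : Fin n → ZMod q, (∏ i, (ν (η i)).toReal) * h (∑ i, z i + ∑ i, η i) := by
  unfold noisyDensity
  simp only [Finset.sum_mul]
  rw [Finset.sum_comm]
  refine Finset.sum_congr rfl fun η _ => ?_
  simp only [mul_assoc, shuffledDensity_mul_apply_sum]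
  rw [← Finset.mul_sum, ← Finset.sum_mul, sum_shuffledDensity, one_mul]
  simp [Finset.sum_add_distrib]

end View

section ProductDensities

open Finset

variable {d : ℕ} {W : Type} [Fintype W]

lemma sum_abs_prod_sub_prod_le (a b : Fin d → W → ℝ) (ha : ∀ c w, 0 ≤ a c w)
    (hb : ∀ c w, 0 ≤ b c w) (ha1 : ∀ c, ∑ w, a c w = 1) (hb1 : ∀ c, ∑ w, b c w = 1) :
    ∑ v : Fin d → W, |∏ c, a c (v c) - ∏ c, b c (v c)| ≤ ∑ c, ∑ w, |a c w - b c w| := by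
  induction d with
  | zero => simp
  | succ d ih =>
    have ih := ih (fun c => a c.succ) (fun c => b c.succ) (fun c => ha _) (fun c => hb _)
      (fun c => ha1 _) (fun c => hb1 _)
    have hA : ∑ v : Fin d → W, ∏ c, a (Fin.succ c) (v c) = 1 := by
      rw [← Fintype.prod_sum (fun c w => a (Fin.succ c) w)]
      simp [ha1]
    rw [← Equiv.sum_comp (Fin.consEquiv fun _ : Fin (d + 1) => W), Fintype.sum_prod_type,
      Fin.sum_univ_succ]
    calc _ ≤ ∑ w : W, ∑ v : Fin d → W, (|a 0 w - b 0 w| * ∏ c, a (Fin.succ c) (v c) +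
          b 0 w * |∏ c, a (Fin.succ c) (v c) - ∏ c, b (Fin.succ c) (v c)|) := by
          refine Finset.sum_le_sum fun w _ => Finset.sum_le_sum fun v _ => ?_
          simp only [Fin.consEquiv, Equiv.coe_fn_mk, Fin.prod_univ_succ, Fin.cons_zero,
            Fin.cons_succ]
          rw [show ∀ x y X Y : ℝ, x * X - y * Y = (x - y) * X + y * (X - Y) by intros; ring]
          refine (abs_add_le _ _).trans ?_
          rw [abs_mul, abs_mul, abs_of_nonneg (hb 0 w),
            abs_of_nonneg (Finset.prod_nonneg fun c _ => ha _ _)]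
      _ = ∑ w, |a 0 w - b 0 w| +
          ∑ v : Fin d → W, |∏ c, a (Fin.succ c) (v c) - ∏ c, b (Fin.succ c) (v c)| := by
          simp only [Finset.sum_add_distrib, ← Finset.mul_sum, ← Finset.sum_mul, hA, hb1, mul_one,
            one_mul]
      _ ≤ _ := by gcongr

lemma sum_prod_mul_apply (a : Fin d → W → ℝ) (ha1 : ∀ c, ∑ w, a c w = 1) (k : Fin d)
    (H : W → ℝ) : ∑ v : Fin d → W, (∏ c, a c (v c)) * H (v k) = ∑ w, a k w * H w := by
  have h1 : ∀ v : Fin d → W, (∏ c, a c (v c)) * H (v k) =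
      ∏ c, (a c (v c) * if c = k then H (v c) else 1) := by
    intro v
    rw [Finset.prod_mul_distrib, Finset.prod_ite_eq' univ k]
    simp
  rw [Finset.sum_congr rfl fun v _ => h1 v,
    ← Fintype.prod_sum (fun c w => a c w * if c = k then H w else 1)]
  rw [Finset.prod_eq_single k]
  · simp
  · intro c _ hc
    simp [hc, ha1]
  · simp

end ProductDensities

section Privacy

open Finset

/-- A mechanism that is close in total variation to a purely private family of densities is
approximately private. -/
lemma isDP_of_sum_abs_sub_le {n : ℕ} {X Ω : Type} [Fintype Ω] {ε δ τ : ℝ}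
    (A : (Fin n → X) → PMF Ω) (B : (Fin n → X) → Ω → ℝ)
    (hAB : ∀ x, ∑ v, |(A x v).toReal - B x v| ≤ τ)
    (hB : ∀ x x' : Fin n → X, (∃ i, ∀ j, j ≠ i → x j = x' j) → ∀ v,
      B x v ≤ Real.exp ε * B x' v)
    (hδ : τ * (1 + Real.exp ε) ≤ δ) : IsDP ε δ A := by
  classical
  intro x x' hx T
  have hT : ∀ x, (A x).toOuterMeasure T =
      ENNReal.ofReal (∑ v with v ∈ T, (A x v).toReal) := by
    intro x
    rw [PMF.toOuterMeasure_apply_fintype, ENNReal.ofReal_sum_of_nonneg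
      fun v _ => ENNReal.toReal_nonneg, Finset.sum_filter]
    refine Finset.sum_congr rfl fun v _ => ?_
    rw [Set.indicator_apply]
    split_ifs
    · rw [ENNReal.ofReal_toReal (PMF.apply_ne_top _ _)]
    · rfl
  have hclose : ∀ x, |∑ v with v ∈ T, (A x v).toReal - ∑ v with v ∈ T, B x v| ≤ τ := by
    intro x
    rw [← Finset.sum_sub_distrib]
    refine (Finset.abs_sum_le_sum_abs _ _).trans (le_trans ?_ (hAB x))
    exact Finset.sum_le_sum_of_subset_of_nonneg (subset_univ _) fun v _ _ => abs_nonneg _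
  have hnn : 0 ≤ ∑ v with v ∈ T, (A x' v).toReal :=
    Finset.sum_nonneg fun v _ => ENNReal.toReal_nonneg
  have hτ : 0 ≤ τ := (abs_nonneg _).trans (hclose x)
  have hmain : ∑ v with v ∈ T, (A x v).toReal ≤
      Real.exp ε * ∑ v with v ∈ T, (A x' v).toReal + δ := by
    have h1 := (abs_le.1 (hclose x)).2
    have h2 := (abs_le.1 (hclose x')).1
    have h3 : ∑ v with v ∈ T, B x v ≤ Real.exp ε * ∑ v with v ∈ T, B x' v := by
      rw [Finset.mul_sum]
      exact Finset.sum_le_sum fun v _ => hB x x' hx v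
    have h4 : Real.exp ε * ∑ v with v ∈ T, B x' v ≤
        Real.exp ε * (∑ v with v ∈ T, (A x' v).toReal + τ) :=
      mul_le_mul_of_nonneg_left (by linarith) (Real.exp_pos _).le
    linarith
  have hδ0 : 0 ≤ δ := le_trans (mul_nonneg hτ (by positivity)) hδ
  rw [hT, hT, ← ENNReal.ofReal_mul (Real.exp_pos _).le,
    ← ENNReal.ofReal_add (mul_nonneg (Real.exp_pos _).le hnn) hδ0]
  exact ENNReal.ofReal_le_ofReal hmain

end Privacy

section Summation

open Finset

variable {q : ℕ} [NeZero q] {n m d : ℕ}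

/-- The density of the shuffled shares when a single party holds `s` plus the noise of all
parties. -/
noncomputable def idealDensity [NeZero n] (ν : PMF (ZMod q))
    (p : Fin (m + 1) → PMF (Equiv.Perm (Fin n))) (s : ZMod q)
    (w : Fin (m + 1) → Fin n → ZMod q) : ℝ :=
  ∑ η : Fin n → ZMod q, (∏ i, (ν (η i)).toReal) * shuffledDensity p (Pi.single 0 (s + ∑ i, η i)) w

lemma idealDensity_nonneg [NeZero n] (ν : PMF (ZMod q))
    (p : Fin (m + 1) → PMF (Equiv.Perm (Fin n))) (s : ZMod q)
    (w : Fin (m + 1) → Fin n → ZMod q) : 0 ≤ idealDensity ν p s w :=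
  Finset.sum_nonneg fun _ _ => mul_nonneg (Finset.prod_nonneg fun _ _ => ENNReal.toReal_nonneg)
    (shuffledDensity_nonneg _ _ _)

lemma sum_idealDensity [NeZero n] (ν : PMF (ZMod q))
    (p : Fin (m + 1) → PMF (Equiv.Perm (Fin n))) (s : ZMod q) :
    ∑ w, idealDensity ν p s w = 1 := by
  unfold idealDensity
  rw [Finset.sum_comm, ← sum_prod_toReal (fun _ : Fin n => ν)]
  refine Finset.sum_congr rfl fun η _ => ?_
  rw [← Finset.mul_sum, sum_shuffledDensity, mul_one]

lemma sum_abs_noisyDensity_sub_idealDensity_le [NeZero n] (ν : PMF (ZMod q))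
    {p : Fin (m + 1) → PMF (Equiv.Perm (Fin n))} {τ : ℝ}
    (hτ : ∀ s s' : Fin n → ZMod q, ∑ i, s i = ∑ i, s' i →
      ∑ w, |shuffledDensity p s w - shuffledDensity p s' w| ≤ τ) (z : Fin n → ZMod q) :
    ∑ w, |noisyDensity ν p z w - idealDensity ν p (∑ i, z i) w| ≤ τ := by
  calc _ ≤ ∑ w, ∑ η : Fin n → ZMod q, (∏ i, (ν (η i)).toReal) *
        |shuffledDensity p (z + η) w -
          shuffledDensity p (Pi.single 0 (∑ i, z i + ∑ i, η i)) w| := by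
        refine Finset.sum_le_sum fun w _ => ?_
        unfold noisyDensity idealDensity
        rw [← Finset.sum_sub_distrib]
        refine (Finset.abs_sum_le_sum_abs _ _).trans (le_of_eq ?_)
        refine Finset.sum_congr rfl fun η _ => ?_
        rw [← mul_sub, abs_mul, abs_of_nonneg (Finset.prod_nonneg fun _ _ =>
          ENNReal.toReal_nonneg)]
    _ ≤ ∑ η : Fin n → ZMod q, (∏ i, (ν (η i)).toReal) * τ := by
        rw [Finset.sum_comm]
        refine Finset.sum_le_sum fun η _ => ?_
        rw [← Finset.mul_sum]
        refine mul_le_mul_of_nonneg_left (hτ _ _ ?_)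
          (Finset.prod_nonneg fun _ _ => ENNReal.toReal_nonneg)
        rw [Finset.sum_pi_single']
        simp [Finset.sum_add_distrib]
    _ = τ := by rw [← Finset.sum_mul, sum_prod_toReal (fun _ : Fin n => ν), one_mul]

lemma pow_mul_idealDensity_le [NeZero n] {α : ℝ} (hα : 0 < α) (hα1 : α < 1) (hn : 0 < n)
    (p : Fin (m + 1) → PMF (Equiv.Perm (Fin n))) (s : ZMod q) (k : ℤ)
    (w : Fin (m + 1) → Fin n → ZMod q) :
    α ^ k.natAbs * idealDensity (noisePMF q hα hα1 hn) p (s + k) w ≤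
      idealDensity (noisePMF q hα hα1 hn) p s w := by
  have h := noise_shift_le hα hα1 hn (fun g : ZMod q => shuffledDensity p (Pi.single 0 (s + g)) w)
    (fun g => shuffledDensity_nonneg _ _ _) k
  unfold idealDensity
  convert h using 6
  abel_nf

lemma sum_abs_shuffledDensity_sub_le (hn : 2 ≤ n) {γ τ : ℝ} (hγ : 0 ≤ γ) (hτ : 0 < τ)
    (hτ1 : τ ≤ 1) (hq : q = 4 * n ^ 2)
    (hm : 13 + 4 * (Real.logb 2 (32 / τ ^ 2) / Real.logb 2 n) ≤ Real.exp (-γ) * m)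
    {p : Fin (m + 1) → PMF (Equiv.Perm (Fin n))} (hp : ∀ t, IsImperfectShuffler γ (p t))
    (s s' : Fin n → ZMod q) (hs : ∑ i, s i = ∑ i, s' i) :
    ∑ w, |shuffledDensity p s w - shuffledDensity p s' w| ≤ τ := by
  have hn1 : (1 : ℝ) < n := by exact_mod_cast hn
  have hn0 : (0 : ℝ) < n := by linarith
  set κ := Real.exp (-γ) * m with hκ
  set L := Real.logb 2 (32 / τ ^ 2) / Real.logb 2 n with hL
  have hτ2 : τ ^ 2 ≤ 1 := pow_le_one₀ hτ.le hτ1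
  have hL0 : 0 ≤ L := div_nonneg
    (Real.logb_nonneg (by norm_num) (by rw [le_div_iff₀ (by positivity)]; linarith))
    (Real.logb_nonneg (by norm_num) hn1.le)
  have hnL : (n : ℝ) ^ L = 32 / τ ^ 2 := by
    have : L = Real.logb n (32 / τ ^ 2) := by
      rw [hL, Real.logb, Real.logb, Real.logb, div_div_div_cancel_right₀]
      exact (Real.log_pos (by norm_num)).ne'
    rw [this, Real.rpow_logb hn0 hn1.ne' (by positivity)]
  set x : ℝ := (n : ℝ) ^ (-((κ - 1) / 4)) with hx
  have hx0 : 0 < x := Real.rpow_pos_of_pos hn0 _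
  have hxle : x ≤ ((n : ℝ) ^ 3)⁻¹ * (τ ^ 2 / 32) := by
    calc x ≤ (n : ℝ) ^ (-(3 + L)) := Real.rpow_le_rpow_of_exponent_le hn1.le (by linarith)
      _ = _ := by
        rw [Real.rpow_neg hn0.le, Real.rpow_add hn0, hnL, mul_inv, inv_div]
        norm_cast
  set Y : ℝ := q * (n * x) with hY
  have hYle : Y ≤ τ ^ 2 / 8 := by
    calc Y = 4 * (n : ℝ) ^ 3 * x := by rw [hY, hq]; push_cast; ring
      _ ≤ 4 * (n : ℝ) ^ 3 * (((n : ℝ) ^ 3)⁻¹ * (τ ^ 2 / 32)) := by gcongr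
      _ = _ := by field_simp; norm_num
  have hY0 : 0 ≤ Y := by positivity
  have hpow : (1 + n * x) ^ q - 1 ≤ 2 * Y := by
    have h1 : (1 + n * x) ^ q ≤ Real.exp Y := by
      rw [hY, Real.exp_nat_mul]
      refine pow_le_pow_left₀ (by positivity) ?_ _
      rw [add_comm]; exact Real.add_one_le_exp _
    have h2 := Real.abs_exp_sub_one_le (x := Y) (by rw [abs_of_nonneg hY0]; linarith)
    rw [abs_of_nonneg hY0] at h2
    have h3 := (abs_le.1 h2).2
    linarith
  have h1 := sq_sum_abs_shuffledDensity_sub_le hγ hp hs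
  have h2 := sum_multinom_rpow_le (V := ZMod q) (n := n) (by omega) (κ := κ) (by linarith)
  rw [ZMod.card] at h2
  refine abs_le_of_sq_le_sq' ?_ hτ.le |>.2
  linarith

lemma abs_valMinAbs_sub_le (hn : 0 < n) (hq : q = 4 * n ^ 2) {s : ℕ} (hs : s ≤ n ^ 2) (j : ℤ) :
    |((s : ZMod q) + (j : ZMod q)).valMinAbs - s| ≤ 3 * |j| := by
  have hn2 : 0 < n ^ 2 := by positivity
  have hqz : (q : ℤ) = 4 * (n ^ 2 : ℕ) := by rw [hq]; push_cast; ring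
  generalize n ^ 2 = N at *
  rcases lt_or_ge |j| N with hj | hj
  · have h : ((s : ZMod q) + (j : ZMod q)).valMinAbs = s + j := by
      rw [ZMod.valMinAbs_spec]
      refine ⟨by push_cast; rfl, ?_⟩
      rw [abs_lt] at hj
      constructor <;> omega
    rw [h, add_sub_cancel_left]
    linarith [abs_nonneg j]
  · have h := ZMod.valMinAbs_mem_Ioc ((s : ZMod q) + (j : ZMod q))
    generalize ((s : ZMod q) + (j : ZMod q)).valMinAbs = a at *
    have h1 := h.1
    have h2 := h.2
    rw [abs_le]
    constructor <;> omega

lemma floor_le_of_mem_Icc (n : ℕ) (x : Set.Icc (0 : ℝ) 1) : ⌊(n : ℝ) * (x : ℝ)⌋₊ ≤ n := by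
  have h := Nat.floor_le_floor (mul_le_of_le_one_right (Nat.cast_nonneg (α := ℝ) n) x.2.2)
  rwa [Nat.floor_natCast] at h

lemma abs_decode_sub_sum_le (hn : 0 < n) (hq : q = 4 * n ^ 2) (x : Fin n → Set.Icc (0 : ℝ) 1)
    (j : ℤ) :
    |((∑ i, (⌊(n : ℝ) * (x i : ℝ)⌋₊ : ZMod q) + (j : ZMod q)).valMinAbs : ℝ) / n - ∑ i, (x i : ℝ)| ≤
      3 / n * j.natAbs + 1 := by
  have hn0 : (0 : ℝ) < n := by exact_mod_cast hn
  set s : ℕ := ∑ i, ⌊(n : ℝ) * (x i : ℝ)⌋₊ with hs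
  have hsle : s ≤ n ^ 2 := by
    calc s ≤ ∑ _i : Fin n, n := Finset.sum_le_sum fun i _ => floor_le_of_mem_Icc n (x i)
      _ = n ^ 2 := by simp [sq]
  have h1 : |(((s : ZMod q) + (j : ZMod q)).valMinAbs : ℝ) - s| ≤ 3 * j.natAbs := by
    rw [Nat.cast_natAbs]
    exact_mod_cast abs_valMinAbs_sub_le hn hq hsle j
  have h2 : |(s : ℝ) - n * ∑ i, (x i : ℝ)| ≤ n := by
    rw [hs, Nat.cast_sum, Finset.mul_sum, ← Finset.sum_sub_distrib]
    refine (Finset.abs_sum_le_sum_abs _ _).trans ?_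
    calc _ ≤ ∑ _i : Fin n, (1 : ℝ) := by
          refine Finset.sum_le_sum fun i _ => ?_
          have h3 := Nat.floor_le (mul_nonneg hn0.le (x i).2.1)
          have h4 := Nat.lt_floor_add_one ((n : ℝ) * (x i : ℝ))
          rw [abs_le]
          constructor <;> linarith
      _ = n := by simp
  have h3 : (∑ i, (⌊(n : ℝ) * (x i : ℝ)⌋₊ : ZMod q)) = (s : ZMod q) := by
    rw [hs, Nat.cast_sum]
  rw [h3]
  generalize (((s : ZMod q) + (j : ZMod q)).valMinAbs : ℝ) = a at *
  have h4 : a / n - ∑ i, (x i : ℝ) = (a - s) / n + (s - n * ∑ i, (x i : ℝ)) / n := by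
    field_simp; ring
  rw [h4]
  refine (abs_add_le _ _).trans (add_le_add ?_ ?_)
  · rw [abs_div, abs_of_pos hn0, div_mul_eq_mul_div]
    gcongr
  · rw [abs_div, abs_of_pos hn0, div_le_one hn0]
    exact h2

lemma vectorSum_expectedAbsError_le {α : ℝ} (hα : 0 < α) (hα1 : α < 1) (hn : 0 < n)
    (hq : q = 4 * n ^ 2) (S : Fin (d * (m + 1)) → PMF (Equiv.Perm (Fin n)))
    (x : Fin n → Fin d → Set.Icc (0 : ℝ) 1) (k : Fin d) :
    (vectorSum (noisePMF q hα hα1 hn) n m d).expectedAbsError S x k ≤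
      3 / n * (2 * (α / (1 - α))) + 1 := by
  set ν := noisePMF q hα hα1 hn with hν
  let h : ZMod q → ℝ := fun g => |(g.valMinAbs : ℝ) / n - ∑ i, (x i k : ℝ)|
  have h1 : (vectorSum ν n m d).expectedAbsError S x k =
      ∑ η : Fin n → ZMod q, (∏ i, (ν (η i)).toReal) *
        h (∑ i, (⌊(n : ℝ) * (x i k : ℝ)⌋₊ : ZMod q) + ∑ i, η i) := by
    rw [← sum_noisyDensity_mul ν (splitRounds _ S k)
      (fun i => (⌊(n : ℝ) * (x i k : ℝ)⌋₊ : ZMod q)) h]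
    rw [← sum_prod_mul_apply (fun c => noisyDensity ν (splitRounds _ S c)
      (fun i => (⌊(n : ℝ) * (x i c : ℝ)⌋₊ : ZMod q))) (fun c => sum_noisyDensity _ _ _) k
      (fun w => h (∑ t, ∑ k, w t k)),
      ← Equiv.sum_comp (splitRounds (Fin n → ZMod q))]
    unfold ShuffleProtocol.expectedAbsError
    refine Finset.sum_congr rfl fun v _ => ?_
    rw [vectorSum_view_toReal]
    rfl
  rw [h1]
  exact noise_expectation_le hα hα1 hn
    (fun g => h (∑ i, (⌊(n : ℝ) * (x i k : ℝ)⌋₊ : ZMod q) + g)) (fun g => abs_nonneg _)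
    (by positivity) zero_le_one (fun j => abs_decode_sub_sum_le hn hq (fun i => x i k) j)

lemma vectorSum_isDP (hn : 2 ≤ n) {α ε ε' δ τ γ : ℝ} (hα : 0 < α) (hα1 : α < 1) (hn' : 0 < n)
    (hαε : Real.exp (-(ε / d)) ≤ α ^ n) (hd : 1 ≤ d) (hε : ε ≤ ε')
    (hγ : 0 ≤ γ) (hτ : 0 < τ) (hτ1 : τ ≤ 1) (hq : q = 4 * n ^ 2)
    (hm : 13 + 4 * (Real.logb 2 (32 / τ ^ 2) / Real.logb 2 n) ≤ Real.exp (-γ) * m)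
    (hδ : d * τ * (1 + Real.exp ε') ≤ δ)
    {S : Fin (d * (m + 1)) → PMF (Equiv.Perm (Fin n))} (hS : ∀ j, IsImperfectShuffler γ (S j)) :
    IsDP ε δ ((vectorSum (noisePMF q hα hα1 hn') n m d).view S) := by
  have : NeZero n := ⟨by omega⟩
  set ν := noisePMF q hα hα1 hn' with hν
  let z : (Fin n → Fin d → Set.Icc (0 : ℝ) 1) → Fin d → Fin n → ZMod q :=
    fun x c i => (⌊(n : ℝ) * (x i c : ℝ)⌋₊ : ZMod q)
  have hSc : ∀ c t, IsImperfectShuffler γ (splitRounds _ S c t) := fun c t => hS _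
  have hd0 : (0 : ℝ) < d := by exact_mod_cast hd
  refine isDP_of_sum_abs_sub_le (τ := d * τ) _
    (fun x v => ∏ c, idealDensity ν (splitRounds _ S c) (∑ i, z x c i) (splitRounds _ v c)) ?_ ?_ ?_
  · intro x
    simp only [vectorSum_view_toReal]
    rw [Equiv.sum_comp (splitRounds (Fin n → ZMod q)) (fun V : Fin d → Fin (m + 1) → Fin n → ZMod q =>
      |∏ c, noisyDensity ν (splitRounds _ S c) (z x c) (V c) -
        ∏ c, idealDensity ν (splitRounds _ S c) (∑ i, z x c i) (V c)|)]
    refine (sum_abs_prod_sub_prod_le _ _ (fun c w => noisyDensity_nonneg _ _ _ _)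
      (fun c w => idealDensity_nonneg _ _ _ _) (fun c => sum_noisyDensity _ _ _)
      (fun c => sum_idealDensity _ _ _)).trans ?_
    calc _ ≤ ∑ _c : Fin d, τ := Finset.sum_le_sum fun c _ =>
          sum_abs_noisyDensity_sub_idealDensity_le ν
            (sum_abs_shuffledDensity_sub_le hn hγ hτ hτ1 hq hm (hSc c)) _
      _ = d * τ := by simp
  · rintro x x' ⟨i, hi⟩ v
    have hc : ∀ c, idealDensity ν (splitRounds _ S c) (∑ i, z x c i) (splitRounds _ v c) ≤
        Real.exp (ε / d) *
          idealDensity ν (splitRounds _ S c) (∑ i, z x' c i) (splitRounds _ v c) := by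
      intro c
      set k : ℤ := (⌊(n : ℝ) * (x i c : ℝ)⌋₊ : ℤ) - (⌊(n : ℝ) * (x' i c : ℝ)⌋₊ : ℤ) with hk
      have hsum : ∑ i, z x c i = ∑ i, z x' c i + k := by
        rw [← Finset.add_sum_erase univ _ (mem_univ i),
          ← Finset.add_sum_erase univ (z x' c) (mem_univ i),
          Finset.sum_congr rfl (g := z x' c) fun j hj => by
            simp only [z, hi j (ne_of_mem_erase hj)]]
        simp only [z, hk]
        push_cast
        ring
      have hkn : k.natAbs ≤ n := by
        have h1 := floor_le_of_mem_Icc n (x i c)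
        have h2 := floor_le_of_mem_Icc n (x' i c)
        omega
      have h := pow_mul_idealDensity_le hα hα1 hn' (splitRounds _ S c) (∑ i, z x' c i) k
        (splitRounds _ v c)
      rw [← hsum] at h
      have h0 := idealDensity_nonneg ν (splitRounds _ S c) (∑ i, z x c i) (splitRounds _ v c)
      have h3 : Real.exp (-(ε / d)) *
          idealDensity ν (splitRounds _ S c) (∑ i, z x c i) (splitRounds _ v c) ≤
          idealDensity ν (splitRounds _ S c) (∑ i, z x' c i) (splitRounds _ v c) :=
        (mul_le_mul_of_nonneg_right (hαε.trans (pow_le_pow_of_le_one hα.le hα1.le hkn)) h0).trans h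
      calc _ = Real.exp (ε / d) * (Real.exp (-(ε / d)) *
            idealDensity ν (splitRounds _ S c) (∑ i, z x c i) (splitRounds _ v c)) := by
            rw [← mul_assoc, ← Real.exp_add, add_neg_cancel, Real.exp_zero, one_mul]
        _ ≤ _ := mul_le_mul_of_nonneg_left h3 (Real.exp_pos _).le
    refine (Finset.prod_le_prod (fun c _ => idealDensity_nonneg _ _ _ _) fun c _ => hc c).trans ?_
    rw [Finset.prod_mul_distrib]
    refine le_of_eq ?_
    rw [prod_const, card_univ, Fintype.card_fin, ← Real.exp_nat_mul]
    congr 2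
    field_simp
  · refine le_trans (mul_le_mul_of_nonneg_left ?_ (by positivity)) hδ
    linarith [Real.exp_le_exp.2 hε]

end Summation

section Parameters

open Finset

lemma clog_four_mul_sq_le {n : ℕ} (hn : 2 ≤ n) :
    (Nat.clog 2 (4 * n ^ 2) : ℝ) ≤ 3 * Real.logb 2 ⌈2 * (n : ℝ) ^ (3 / 2 : ℝ)⌉₊ := by
  have hn1 : (1 : ℝ) ≤ n := by exact_mod_cast (by omega : 1 ≤ n)
  have hn2 : (2 : ℝ) ≤ n := by exact_mod_cast hn
  set Q : ℝ := (⌈2 * (n : ℝ) ^ (3 / 2 : ℝ)⌉₊ : ℝ) with hQ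
  have hQn : 2 * (n : ℝ) ≤ Q := by
    refine le_trans ?_ (Nat.le_ceil _)
    have : (n : ℝ) ^ (1 : ℝ) ≤ (n : ℝ) ^ (3 / 2 : ℝ) :=
      Real.rpow_le_rpow_of_exponent_le hn1 (by norm_num)
    rw [Real.rpow_one] at this
    linarith
  have h1 : (Nat.clog 2 (4 * n ^ 2) : ℝ) ≤ Real.logb 2 (4 * (n : ℝ) ^ 2) + 1 := by
    have h := Real.natCeil_logb_natCast 2 (4 * n ^ 2)
    rw [← h]
    have h0 : 0 ≤ Real.logb (2 : ℕ) ((4 * n ^ 2 : ℕ) : ℝ) := by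
      push_cast
      exact Real.logb_nonneg (by norm_num) (by nlinarith)
    refine (Nat.ceil_lt_add_one h0).le.trans (le_of_eq ?_)
    push_cast
    rfl
  have h2 : Real.logb 2 (4 * (n : ℝ) ^ 2) ≤ 2 * Real.logb 2 Q := by
    rw [show 2 * Real.logb 2 Q = Real.logb 2 (Q ^ 2) by rw [Real.logb_pow]; push_cast; ring]
    exact Real.logb_le_logb_of_le (by norm_num) (by positivity) (by nlinarith)
  have h3 : 1 ≤ Real.logb 2 Q := by
    rw [Real.le_logb_iff_rpow_le (by norm_num) (by linarith)]
    rw [Real.rpow_one]; linarith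
  linarith

lemma exp_neg_div_le_inv {u : ℝ} (hu : 0 < u) :
    Real.exp (-u) / (1 - Real.exp (-u)) ≤ 1 / u := by
  have h1 : Real.exp (-u) < 1 := (Real.exp_lt_exp.2 (by linarith)).trans_eq Real.exp_zero
  rw [div_le_div_iff₀ (by linarith) hu]
  have h2 := Real.add_one_le_exp u
  have h3 : Real.exp (-u) * Real.exp u = 1 := by rw [← Real.exp_add]; simp
  nlinarith [Real.exp_pos (-u)]

end Parameters

theorem mainTheorem3 (ε₀ : ℝ) (hε₀ : 0 < ε₀) :
    ∃ C : ℝ, 0 < C ∧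
      ∀ (n d : ℕ), 19 ≤ n → 1 ≤ d →
      ∀ ε δ γ : ℝ, 0 < ε → ε ≤ ε₀ → 0 < δ → δ < 1 →
        0 ≤ γ → γ ≤ Real.logb 2 (Real.logb 2 n) / 80 →
      ∃ (m : ℕ) (M : Type) (_ : Fintype M)
        (P : ShuffleProtocol (Fin d → Set.Icc (0 : ℝ) 1) M (Fin d → ℝ) n m),
        (m : ℝ) ≤ C * (d * (Real.exp (4 * γ) +
          Real.exp (4 * γ) * (Real.logb 2 (d / δ) + Real.logb 2 n) / Real.logb 2 n)) ∧
        (Nat.clog 2 (Fintype.card M) : ℝ) ≤ C * Real.logb 2 ⌈2 * (n : ℝ) ^ (3 / 2 : ℝ)⌉₊ ∧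
        ∀ S : Fin m → PMF (Equiv.Perm (Fin n)), (∀ j, IsImperfectShuffler γ (S j)) →
          IsDP ε δ (P.view S) ∧
          ∀ (x : Fin n → Fin d → Set.Icc (0 : ℝ) 1) (k : Fin d),
            P.expectedAbsError S x k ≤ C * (d / ε) := by
  set E := 1 + Real.exp ε₀ with hE
  have hE1 : 1 ≤ E := by rw [hE]; linarith [Real.exp_pos ε₀]
  have hlE : 0 ≤ Real.logb 2 E := Real.logb_nonneg (by norm_num) hE1
  refine ⟨35 + 8 * Real.logb 2 E + ε₀, by positivity, ?_⟩
  intro n d hn hd ε δ γ hε hεε₀ hδ hδ1 hγ _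
  have hn0 : (0 : ℝ) < n := by exact_mod_cast (by omega : 0 < n)
  have hd1 : (1 : ℝ) ≤ d := by exact_mod_cast hd
  have hd0 : (0 : ℝ) < d := by linarith
  set τ : ℝ := δ / (d * E) with hτ
  have hτ0 : 0 < τ := by positivity
  have hτ1 : τ ≤ 1 := by
    rw [hτ, div_le_one (by positivity)]
    nlinarith
  set l := Real.logb 2 n with hl
  have hl1 : 1 ≤ l := by
    rw [hl, Real.le_logb_iff_rpow_le (by norm_num) hn0, Real.rpow_one]
    exact_mod_cast (by omega : 2 ≤ n)
  set κ := 13 + 4 * (Real.logb 2 (32 / τ ^ 2) / l) with hκ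
  set m := ⌈κ * Real.exp γ⌉₊ with hm
  have : NeZero (4 * n ^ 2) := ⟨by positivity⟩
  set α := Real.exp (-(ε / (d * n))) with hα
  have hα0 : 0 < α := Real.exp_pos _
  have hu : 0 < ε / (d * n) := by positivity
  have hα1 : α < 1 := (Real.exp_lt_exp.2 (by linarith)).trans_eq Real.exp_zero
  have hn' : 0 < n := by omega
  have hlδ : 0 ≤ Real.logb 2 (d / δ) :=
    Real.logb_nonneg (by norm_num) (by rw [le_div_iff₀ hδ]; linarith)
  have hlog : Real.logb 2 (32 / τ ^ 2) = 5 + 2 * Real.logb 2 E + 2 * Real.logb 2 (d / δ) := by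
    have h1 : 32 / τ ^ 2 = 32 * (E ^ 2 * (d / δ) ^ 2) := by rw [hτ]; field_simp
    have h2 : Real.logb 2 32 = 5 := by
      rw [show (32 : ℝ) = 2 ^ (5 : ℝ) by norm_num]; exact Real.logb_rpow (by norm_num) (by norm_num)
    rw [h1, Real.logb_mul (by norm_num) (by positivity), Real.logb_mul (by positivity)
      (by positivity), Real.logb_pow, Real.logb_pow, h2]
    push_cast; ring
  have hκ0 : 0 ≤ κ := by rw [hκ, hlog]; positivity
  have hmle : (m : ℝ) ≤ κ * Real.exp γ + 1 :=
    (Nat.ceil_lt_add_one (mul_nonneg hκ0 (Real.exp_pos _).le)).le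
  refine ⟨d * (m + 1), ZMod (4 * n ^ 2), inferInstance,
    vectorSum (noisePMF (4 * n ^ 2) hα0 hα1 hn') n m d, ?_, ?_, fun S hS => ⟨?_, fun x k => ?_⟩⟩
  · set e := Real.exp (4 * γ) with he
    have he1 : 1 ≤ e := Real.one_le_exp (by linarith)
    have hγe : Real.exp γ ≤ e := Real.exp_le_exp.2 (by linarith)
    have h1 : (m : ℝ) + 1 ≤ (κ + 2) * e := by nlinarith
    have h2 : κ + 2 ≤ (35 + 8 * Real.logb 2 E + ε₀) * (1 + (Real.logb 2 (d / δ) + l) / l) := by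
      have h3 : (Real.logb 2 (d / δ) + l) / l = Real.logb 2 (d / δ) / l + 1 := by
        field_simp
      have h4 : κ = 13 + 4 * ((5 + 2 * Real.logb 2 E) / l) + 8 * (Real.logb 2 (d / δ) / l) := by
        rw [hκ, hlog]; ring
      have h5 : (5 + 2 * Real.logb 2 E) / l ≤ 5 + 2 * Real.logb 2 E :=
        div_le_self (by positivity) hl1
      have h6 : 0 ≤ Real.logb 2 (d / δ) / l := div_nonneg hlδ (by linarith)
      rw [h3, h4]
      nlinarith [mul_nonneg hlE h6, mul_nonneg hε₀.le h6]
    push_cast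
    calc (d : ℝ) * (m + 1) ≤ d * ((κ + 2) * e) := by gcongr
      _ ≤ d * ((35 + 8 * Real.logb 2 E + ε₀) * (1 + (Real.logb 2 (d / δ) + l) / l) * e) := by
          gcongr
      _ = _ := by ring
  · rw [ZMod.card]
    refine (clog_four_mul_sq_le (by omega)).trans ?_
    refine mul_le_mul_of_nonneg_right (by linarith) (Real.logb_nonneg (by norm_num) ?_)
    have : 0 < ⌈2 * (n : ℝ) ^ (3 / 2 : ℝ)⌉₊ := Nat.ceil_pos.2 (by positivity)
    exact_mod_cast this
  · refine vectorSum_isDP (by omega) hα0 hα1 hn' (le_of_eq ?_) hd hεε₀ hγ hτ0 hτ1 rfl ?_ ?_ hS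
    · rw [hα, ← Real.exp_nat_mul]
      congr 1
      field_simp
    · calc κ = Real.exp (-γ) * (κ * Real.exp γ) := by
            rw [mul_left_comm, ← Real.exp_add]; simp
        _ ≤ Real.exp (-γ) * m := by
            gcongr
            exact Nat.le_ceil _
    · rw [hτ, ← hE]
      refine le_of_eq ?_
      field_simp
  · refine (vectorSum_expectedAbsError_le hα0 hα1 hn' rfl S x k).trans ?_
    have h1 : α / (1 - α) ≤ d * n / ε := by
      refine (exp_neg_div_le_inv hu).trans (le_of_eq ?_)
      field_simp
    have h2 : 1 ≤ ε₀ * (d / ε) := by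
      rw [← mul_div_assoc, le_div_iff₀ hε]
      nlinarith
    calc 3 / (n : ℝ) * (2 * (α / (1 - α))) + 1 ≤ 3 / (n : ℝ) * (2 * (d * n / ε)) + ε₀ * (d / ε) := by
          gcongr
      _ = (6 + ε₀) * (d / ε) := by field_simp; ring
      _ ≤ _ := by
          refine mul_le_mul_of_nonneg_right ?_ (by positivity)
          linarith
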